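/- **Proposition 5.1.** Let $\mathbb D$ be the open unit disc, $\mathbb T$ the unit circle and $m$ the normalized Lebesgue measure on $\mathbb T$. Let $\Theta$ be an inner function, that is, a bounded analytic function in $\mathbb D$ whose nontangential boundary values are unimodular $m$-a.e. on $\mathbb T$, and let $K^2_\Theta = H^2\ominus\Theta H^2$. Let $\mu$ be a finite Borel measure on $\overline{\mathbb D}$. For $z\in\mathbb D$ let $$k_z(\tau)=\frac{1-\overline{\Theta(z)}\,\Theta(\tau)}{1-\overline z\,\tau}$$ be the reproducing kernel of $K^2_\Theta$ at $z$, and let $\|k_z\|_2$ be its norm in $L^2(\mathbb T,m)$. For $z\in\mathbb T$, if every $f\in K^2_\Theta$ has a nontangential limit at $z$, then $k_z$ is given by the same formula, with $\Theta(z)$ the nontangential limit of $\Theta$ at $z$, and $\|k_z\|_2$ is again its $L^2(\mathbb T,m)$-norm; otherwise $\|k_z\|_2=\infty$. The embedding operator $\mathcal J_\mu:K^2_\Theta\to L^2(\mu)$ is the bounded operator $\mathcal J_\mu f=f$, where the value of $f$ at a point of $\mathbb T$ is its nontangential limit; $\mathcal J_\mu$ is defined if, for every $f\in K^2_\Theta$,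 this limit exists at $\mu$-almost every point of $\mathbb T$ and $f\in L^2(\mu)$, with $\|f\|_{L^2(\mu)}\le C\|f\|_{2}$ for a constant $C$ independent of $f$. Then $\mathcal J_\mu$ is defined and belongs to the Hilbert–Schmidt class $\mathcal S_2$ if and only if the function $z\mapsto\|k_z\|_2$ belongs to $L^2(\mu)$. Moreover, whenever $\mathcal J_\mu$ is defined, $$\|\mathcal J_\mu\|_{\mathcal S_2}^2=\int_{\overline{\mathbb D}}\|k_z\|_2^2\,d\mu(z)$$ as an equality in $[0,\infty]$, where $\|\mathcal J_\mu\|_{\mathcal S_2}^2=\sum_i\|\mathcal J_\mu e_i\|_{L^2(\mu)}^2$ for any orthonormal basis $(e_i)$ of $K^2_\Theta$. -/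

import Mathlib

open MeasureTheory Filter Topology Metric
open scoped ENNReal ComplexConjugate InnerProductSpace

noncomputable section

namespace ModelSpace

/-! ### Nontangential limits and inner functions

The unit circle is parametrised by `UnitAddCircle` through `AddCircle.toCircle`, that is
`θ ↦ exp (2πiθ)`, and the normalized Lebesgue measure `m` on it is `AddCircle.haarAddCircle`. -/

/-- The Stolz angle of aperture `M` with vertex `ζ`. -/
def stolzAngle (M : ℝ) (ζ : ℂ) : Set ℂ :=
  {z | ‖z‖ < 1 ∧ ‖z - ζ‖ < M * (1 - ‖z‖)}

/-- `F` has nontangential limit `c` at the point `ζ` of the unit circle. -/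
def HasNTLimit (F : ℂ → ℂ) (ζ c : ℂ) : Prop :=
  ∀ M : ℝ, Tendsto F (𝓝[stolzAngle M ζ] ζ) (𝓝 c)

theorem HasNTLimit.unique {F : ℂ → ℂ} {ζ c d : ℂ} (hζ : ‖ζ‖ = 1) (hc : HasNTLimit F ζ c)
    (hd : HasNTLimit F ζ d) : c = d := by
  have hne : (𝓝[stolzAngle 2 ζ] ζ).NeBot := by
    rw [← mem_closure_iff_nhdsWithin_neBot]
    have hlim : Tendsto (fun r : ℝ => (r : ℂ) * ζ) (𝓝[<] 1) (𝓝 ζ) := by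
      have h : Tendsto (fun r : ℝ => (r : ℂ) * ζ) (𝓝 1) (𝓝 (((1 : ℝ) : ℂ) * ζ)) :=
        (by fun_prop : Continuous fun r : ℝ => (r : ℂ) * ζ).tendsto 1
      rw [Complex.ofReal_one, one_mul] at h
      exact h.mono_left nhdsWithin_le_nhds
    refine mem_closure_of_tendsto hlim ?_
    filter_upwards [Ioo_mem_nhdsLT (zero_lt_one' ℝ)] with r hr
    have h1 : ‖(r : ℂ) * ζ‖ = r := by
      rw [norm_mul, hζ, mul_one, Complex.norm_real, Real.norm_of_nonneg hr.1.le]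
    have h2 : ‖(r : ℂ) * ζ - ζ‖ = 1 - r := by
      have e : (r : ℂ) * ζ - ζ = ((r - 1 : ℝ) : ℂ) * ζ := by push_cast; ring
      rw [e, norm_mul, hζ, mul_one, Complex.norm_real, Real.norm_eq_abs,
        abs_of_neg (by linarith [hr.2])]
      ring
    refine ⟨by rw [h1]; exact hr.2, ?_⟩
    rw [h1, h2]
    linarith [hr.2]
  exact tendsto_nhds_unique (hc 2) (hd 2)

/-- `Θ` is inner: analytic and bounded in the open unit disc, with unimodular nontangential
boundary values at almost every point of the unit circle. Only the values of `Θ` in the open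
disc matter. -/
structure IsInner (Θ : ℂ → ℂ) : Prop where
  differentiableOn : DifferentiableOn ℂ Θ (ball 0 1)
  bounded : ∃ C : ℝ, ∀ z ∈ ball (0 : ℂ) 1, ‖Θ z‖ ≤ C
  unimodular : ∀ᵐ θ : UnitAddCircle ∂AddCircle.haarAddCircle,
    ∃ c : ℂ, ‖c‖ = 1 ∧ HasNTLimit Θ (AddCircle.toCircle θ) c

open Classical in
/-- The value of `F` at a point of the closed disc: `F z` itself in the open disc, and the
nontangential limit on the circle where it exists (`0` where it does not). -/
def value (F : ℂ → ℂ) (z : ℂ) : ℂ :=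
  if ‖z‖ < 1 then F z
  else if h : ∃ c, HasNTLimit F z c then h.choose else 0

/-! ### The Hardy space and the model space -/

/-- The space `L²(𝕋, m)`. -/
abbrev LTwo : Type := Lp ℂ 2 (AddCircle.haarAddCircle (T := (1 : ℝ)))

/-- The Hardy space `H²`, identified with the closed subspace of `L²(𝕋, m)` of all functions
whose Fourier coefficients of negative index vanish. -/
def hardy : Submodule ℂ LTwo :=
  (Submodule.span ℂ
    (Set.range fun n : ℕ => (fourierLp 2 (-((n : ℤ) + 1)) : LTwo)))ᗮ

/-- The analytic function in the disc with boundary function `f`: `z ↦ ∑ n ≥ 0, f̂(n) zⁿ`. -/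
def discExtension (f : LTwo) (z : ℂ) : ℂ :=
  ∑' n : ℕ, fourierCoeff (f : UnitAddCircle → ℂ) (n : ℤ) * z ^ n

/-- The set `Θ H²`, as a subset of `L²(𝕋, m)`. -/
def innerMultiples (Θ : ℂ → ℂ) : Set LTwo :=
  {F | ∃ g ∈ hardy, (F : UnitAddCircle → ℂ) =ᵐ[AddCircle.haarAddCircle]
    fun θ => value Θ (AddCircle.toCircle θ) * (g : UnitAddCircle → ℂ) θ}

/-- The model space `K²_Θ = H² ⊖ Θ H²`. -/
def modelSpace (Θ : ℂ → ℂ) : Submodule ℂ LTwo :=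
  hardy ⊓ (Submodule.span ℂ (innerMultiples Θ))ᗮ

instance instCompleteSpaceModelSpace (Θ : ℂ → ℂ) : CompleteSpace (modelSpace Θ) := by
  have h : IsClosed (modelSpace Θ : Set LTwo) :=
    (Submodule.isClosed_orthogonal _).inter (Submodule.isClosed_orthogonal _)
  exact h.completeSpace_coe

/-! ### Reproducing kernels -/

/-- The kernel `k_z(τ) = (1 - conj (Θ z) Θ τ) / (1 - conj z τ)`, for `z` in the closed disc, as a
function on the circle. -/
def kernel (Θ : ℂ → ℂ) (z : ℂ) (θ : UnitAddCircle) : ℂ :=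
  (1 - conj (value Θ z) * value Θ (AddCircle.toCircle θ)) /
    (1 - conj z * (AddCircle.toCircle θ : ℂ))

open Classical in
/-- The norm `‖k_z‖₂ ∈ [0, ∞]` for `z` in the closed disc. At a point `z` of the circle there is a
reproducing kernel exactly when every function of `K²_Θ` has a nontangential limit there;
at all other points of the circle the norm is `∞` by convention. -/
def kernelNorm (Θ : ℂ → ℂ) (z : ℂ) : ℝ≥0∞ :=
  if ‖z‖ < 1 ∨ ∀ f ∈ modelSpace Θ, ∃ c, HasNTLimit (discExtension f) z c then
    eLpNorm (kernel Θ z) 2 AddCircle.haarAddCircle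
  else ∞

/-! ### The embedding operator -/

/-- `J` is the (bounded) embedding operator `J_μ f = f` of `K²_Θ` into `L²(μ)`: for every
`f ∈ K²_Θ`, at `μ`-almost every point `z` of the closed disc, `J f` takes the value of `f` at `z`,
which at a point `z` of the circle means that the nontangential limit of `f` exists and equals
`J f z`. -/
def IsEmbedding (Θ : ℂ → ℂ) (μ : Measure ℂ) (J : modelSpace Θ →L[ℂ] Lp ℂ 2 μ) : Prop :=
  ∀ f : modelSpace Θ, ∀ᵐ z ∂μ,
    (‖z‖ < 1 → (J f : ℂ → ℂ) z = discExtension f z) ∧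
    (‖z‖ = 1 → HasNTLimit (discExtension f) z ((J f : ℂ → ℂ) z))

/-- There is at most one embedding operator. -/
theorem IsEmbedding.unique {Θ : ℂ → ℂ} {μ : Measure ℂ} (hμ : μ (closedBall (0 : ℂ) 1)ᶜ = 0)
    {J J' : modelSpace Θ →L[ℂ] Lp ℂ 2 μ} (hJ : IsEmbedding Θ μ J) (hJ' : IsEmbedding Θ μ J') :
    J = J' := by
  ext1 f
  refine Lp.ext ?_
  have hD : ∀ᵐ z ∂μ, z ∈ closedBall (0 : ℂ) 1 := hμ
  filter_upwards [hD, hJ f, hJ' f] with z hz h h'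
  rcases (mem_closedBall_zero_iff.1 hz).lt_or_eq with hlt | heq
  · rw [h.1 hlt, h'.1 hlt]
  · exact (h.2 heq).unique heq (h'.2 heq)

/-! ### Hilbert–Schmidt operators -/

section HilbertSchmidt

theorem tsum_enorm_inner_sq {E : Type*} [NormedAddCommGroup E] [InnerProductSpace ℂ E]
    {ι : Type*} (b : HilbertBasis ι ℂ E) (x : E) :
    ∑' i, ‖⟪b i, x⟫_ℂ‖ₑ ^ 2 = ‖x‖ₑ ^ 2 := by
  have h1 : HasSum (fun i => ‖⟪b i, x⟫_ℂ‖ ^ 2) (‖x‖ ^ 2) := by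
    have h := Complex.hasSum_re (b.hasSum_inner_mul_inner x x)
    have e : (⟪x, x⟫_ℂ).re = ‖x‖ ^ 2 := by
      simpa using inner_self_eq_norm_sq (𝕜 := ℂ) x
    rw [e] at h
    refine h.congr_fun ?_
    intro i
    rw [← inner_conj_symm x (b i), ← Complex.normSq_eq_conj_mul_self, Complex.ofReal_re,
      Complex.normSq_eq_norm_sq]
  have h2 := ENNReal.ofReal_tsum_of_nonneg (fun i => sq_nonneg ‖⟪b i, x⟫_ℂ‖) h1.summable
  rw [h1.tsum_eq] at h2
  simp only [ENNReal.ofReal_pow (norm_nonneg _), ofReal_norm] at h2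
  exact h2.symm

variable {E F : Type*} [NormedAddCommGroup E] [InnerProductSpace ℂ E] [CompleteSpace E]
  [NormedAddCommGroup F] [InnerProductSpace ℂ F]

/-- The squared Hilbert–Schmidt norm `∑ i, ‖T eᵢ‖² ∈ [0, ∞]`, where `(eᵢ)` is an orthonormal basis
of `E`; it does not depend on the basis, see `hilbertSchmidtNormSq_eq`. -/
def hilbertSchmidtNormSq (T : E →L[ℂ] F) : ℝ≥0∞ :=
  ∑' i, ‖T ((exists_hilbertBasis ℂ E).choose_spec.choose i)‖ₑ ^ 2

/-- `T` is a Hilbert–Schmidt operator, that is, `T ∈ S₂`. -/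
def IsHilbertSchmidt (T : E →L[ℂ] F) : Prop :=
  hilbertSchmidtNormSq T < ∞

theorem tsum_enorm_sq_eq_adjoint [CompleteSpace F] {ι κ : Type*} (b : HilbertBasis ι ℂ E)
    (c : HilbertBasis κ ℂ F) (T : E →L[ℂ] F) :
    ∑' i, ‖T (b i)‖ₑ ^ 2 = ∑' j, ‖ContinuousLinearMap.adjoint T (c j)‖ₑ ^ 2 := by
  rw [tsum_congr fun i => (tsum_enorm_inner_sq c (T (b i))).symm,
    tsum_congr fun j => (tsum_enorm_inner_sq b (ContinuousLinearMap.adjoint T (c j))).symm,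
    ENNReal.tsum_comm]
  refine tsum_congr fun j => tsum_congr fun i => ?_
  rw [ContinuousLinearMap.adjoint_inner_right, ← inner_conj_symm, RCLike.enorm_conj]

/-- The Hilbert–Schmidt norm can be computed in any orthonormal basis. -/
theorem hilbertSchmidtNormSq_eq [CompleteSpace F] {ι : Type*} (b : HilbertBasis ι ℂ E)
    (T : E →L[ℂ] F) : hilbertSchmidtNormSq T = ∑' i, ‖T (b i)‖ₑ ^ 2 := by
  obtain ⟨w, c, -⟩ := exists_hilbertBasis ℂ F
  rw [hilbertSchmidtNormSq, tsum_enorm_sq_eq_adjoint _ c, tsum_enorm_sq_eq_adjoint b c]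

end HilbertSchmidt

end ModelSpace

end

noncomputable section

namespace ModelSpace

/-! ### Boundary values of bounded analytic functions -/

/-! Formally, Tonelli gives `∑ ‖J eᵢ‖² = ∫ ∑ |eᵢ(z)|² dμ`, and Parseval gives `∑ |eᵢ(z)|² = ‖k_z‖²`,
because evaluation at `z` is the inner product with `k_z`. In the open disc this is complete once
`k_z` is known to reproduce (`inner_modelKernel`).

The difficulty lies on the circle. That `J` is defined gives a limit of each `f` off a null set
depending on `f`, whereas a finite `‖k_z‖` requires limits of all `f` at the same `z`. So it must be
shown that, for almost every `z` of the circle, `∑ |J eᵢ(z)|² < ∞` already forces all these limits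
(`ae_kernelNorm_sq_eq`). Riesz–Fischer yields `κ` with `⟪κ, eᵢ⟫ = J eᵢ(z)`, and then `J k_w(z) = ⟪κ,
k_w⟫` for all `w` in a countable dense set (`ae_apply_eq_inner`). The limit of one `k_w` gives a
limit `c` of `Θ` at `z`, and comparing formulas gives `(1 - z̄w) κ(w) = 1 - c̄ Θ(w)` in the whole
disc. Since `‖k_u‖² = (1 - |Θ(u)|²) / (1 - |u|²)`, this identity bounds `‖k_u‖` on each Stolz angle
at `z` (`norm_modelKernel_le`). Bounded evaluations that converge on the dense span of kernels
converge everywhere (`isReproducing_of_dense`).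

Conversely, if `‖k_z‖` is square-integrable, it is finite almost everywhere, and `|f(z)| ≤ ‖f‖
‖k_z‖` makes `f ↦ f` bounded into `L²(μ)`. -/

theorem toCircle_mul_mem_ball {r : ℝ} (hr0 : 0 ≤ r) (hr : r < 1) (θ : UnitAddCircle) :
    (r : ℂ) * (AddCircle.toCircle θ : ℂ) ∈ ball (0 : ℂ) 1 := by
  rw [mem_ball_zero_iff, norm_mul, Circle.norm_coe, mul_one, Complex.norm_real,
    Real.norm_of_nonneg hr0]
  exact hr

/-- `φ` is a bounded analytic function in the disc with radial boundary values `g`. -/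
structure HasBoundary (φ : ℂ → ℂ) (g : UnitAddCircle → ℂ) : Prop where
  differentiableOn : DifferentiableOn ℂ φ (ball 0 1)
  bounded : ∃ C : ℝ, ∀ z ∈ ball (0 : ℂ) 1, ‖φ z‖ ≤ C
  radial : ∀ᵐ θ : UnitAddCircle ∂AddCircle.haarAddCircle,
    Tendsto (fun r : ℝ => φ (r * (AddCircle.toCircle θ : ℂ))) (𝓝[<] 1) (𝓝 (g θ))

/-- A sequence of radii increasing to `1`. -/
def radius (n : ℕ) : ℝ := 1 - 1 / ((n : ℝ) + 1)

theorem radius_nonneg (n : ℕ) : 0 ≤ radius n := by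
  have : 1 / ((n : ℝ) + 1) ≤ 1 := by
    rw [div_le_one (by positivity)]
    linarith [Nat.cast_nonneg (α := ℝ) n]
  unfold radius
  linarith

theorem radius_lt_one (n : ℕ) : radius n < 1 := by
  have : 0 < 1 / ((n : ℝ) + 1) := by positivity
  unfold radius
  linarith

theorem tendsto_radius' : Tendsto radius atTop (𝓝 1) := by
  have h := (tendsto_const_nhds (x := (1 : ℝ))).sub tendsto_one_div_add_atTop_nhds_zero_nat
  rwa [sub_zero] at h

theorem tendsto_radius : Tendsto radius atTop (𝓝[<] 1) :=
  tendsto_nhdsWithin_iff.2 ⟨tendsto_radius', Eventually.of_forall radius_lt_one⟩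

theorem continuous_radial {φ : ℂ → ℂ} (h : DifferentiableOn ℂ φ (ball 0 1)) {r : ℝ} (hr0 : 0 ≤ r)
    (hr : r < 1) : Continuous fun θ : UnitAddCircle => φ (r * (AddCircle.toCircle θ : ℂ)) := by
  refine h.continuousOn.comp_continuous ?_ fun θ => toCircle_mul_mem_ball hr0 hr θ
  exact continuous_const.mul (continuous_subtype_val.comp AddCircle.continuous_toCircle)

theorem fourier_natCast (n : ℕ) (θ : UnitAddCircle) :
    fourier (n : ℤ) θ = (AddCircle.toCircle θ : ℂ) ^ n := by
  rw [fourier_apply, natCast_zsmul, AddCircle.toCircle_nsmul, Circle.coe_pow]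

/-- The power series converges absolutely at `r`, so it may be integrated term by term over the
circle of radius `r`. -/
theorem hasSum_fourierCoeff_radial {φ : ℂ → ℂ} {a : ℕ → ℂ}
    (ha : ∀ z ∈ ball (0 : ℂ) 1, HasSum (fun n => a n * z ^ n) (φ z)) {r : ℝ} (hr0 : 0 ≤ r)
    (hr : r < 1) (n : ℤ) :
    HasSum (fun k : ℕ => a k * r ^ k * (Pi.single (k : ℤ) (1 : ℂ) : ℤ → ℂ) n)
      (fourierCoeff (fun θ : UnitAddCircle => φ (r * (AddCircle.toCircle θ : ℂ))) n) := by
  have hsum : Summable fun k => ‖a k * (r : ℂ) ^ k‖ := by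
    have hr' : (r : ℂ) ∈ ball (0 : ℂ) 1 := by
      rwa [mem_ball_zero_iff, Complex.norm_real, Real.norm_of_nonneg hr0]
    exact (ha _ hr').summable.norm
  have hnorm : ∀ (k : ℕ) (θ : UnitAddCircle),
      ‖fourier (-n) θ • (a k * (r : ℂ) ^ k * fourier (k : ℤ) θ)‖ = ‖a k * (r : ℂ) ^ k‖ := by
    intro k θ
    rw [norm_smul, norm_mul _ (fourier (k : ℤ) θ), fourier_apply, fourier_apply, Circle.norm_coe,
      Circle.norm_coe, one_mul, mul_one]
  have h := hasSum_integral_of_summable_integral_norm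
    (μ := (AddCircle.haarAddCircle : Measure UnitAddCircle))
    (F := fun (k : ℕ) (θ : UnitAddCircle) =>
      fourier (-n) θ • (a k * (r : ℂ) ^ k * fourier (k : ℤ) θ)) ?_ ?_
  · convert! h using 1
    · funext k
      change _ = fourierCoeff (fun θ : UnitAddCircle => a k * (r : ℂ) ^ k * fourier (k : ℤ) θ) n
      rw [fourierCoeff.const_mul, fourierCoeff_fourier]
    · refine integral_congr_ae (Eventually.of_forall fun θ => ?_)
      have h1 := (ha _ (toCircle_mul_mem_ball hr0 hr θ)).const_smul (fourier (-n) θ)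
      have h2 := h1.tsum_eq
      simp only [mul_pow, ← mul_assoc] at h2
      simp only [fourier_natCast]
      exact h2.symm
  · intro k
    refine Continuous.integrable_of_hasCompactSupport ?_ (HasCompactSupport.of_compactSpace _)
    exact (map_continuous (fourier (-n))).smul
      (continuous_const.mul (map_continuous (fourier (k : ℤ))))
  · simpa only [hnorm, integral_const, probReal_univ, one_smul] using hsum

namespace HasBoundary

variable {φ ψ : ℂ → ℂ} {g k : UnitAddCircle → ℂ}

theorem tendsto_radius (h : HasBoundary φ g) : ∀ᵐ θ : UnitAddCircle ∂AddCircle.haarAddCircle,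
    Tendsto (fun n : ℕ => φ (radius n * (AddCircle.toCircle θ : ℂ))) atTop (𝓝 (g θ)) := by
  filter_upwards [h.radial] with θ hθ using hθ.comp ModelSpace.tendsto_radius

theorem aestronglyMeasurable (h : HasBoundary φ g) :
    AEStronglyMeasurable g AddCircle.haarAddCircle :=
  aestronglyMeasurable_of_tendsto_ae atTop
    (fun n => (continuous_radial h.differentiableOn (radius_nonneg n)
      (radius_lt_one n)).aestronglyMeasurable) h.tendsto_radius

theorem memLp_top (h : HasBoundary φ g) : MemLp g ∞ AddCircle.haarAddCircle := by
  obtain ⟨C, hC⟩ := h.bounded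
  refine memLp_top_of_bound h.aestronglyMeasurable C ?_
  filter_upwards [h.tendsto_radius] with θ hθ
  exact le_of_tendsto hθ.norm (Eventually.of_forall fun n =>
    hC _ (toCircle_mul_mem_ball (radius_nonneg n) (radius_lt_one n) θ))

theorem memLp_two (h : HasBoundary φ g) : MemLp g 2 AddCircle.haarAddCircle :=
  h.memLp_top.mono_exponent le_top

/-- Bounded convergence carries Fourier coefficients from the circles of radius `r` to the boundary.
This identifies those of `g` with the Taylor coefficients of `φ`. -/
theorem tendsto_fourierCoeff (h : HasBoundary φ g) (n : ℤ) :
    Tendsto (fun j : ℕ =>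
      fourierCoeff (fun θ : UnitAddCircle => φ (radius j * (AddCircle.toCircle θ : ℂ))) n)
      atTop (𝓝 (fourierCoeff g n)) := by
  obtain ⟨C, hC⟩ := h.bounded
  refine tendsto_integral_of_dominated_convergence (fun _ => C) (fun j => ?_)
    (integrable_const _) (fun j => Eventually.of_forall fun θ => ?_) ?_
  · exact ((map_continuous (fourier (-n))).smul (continuous_radial h.differentiableOn
      (radius_nonneg j) (radius_lt_one j))).aestronglyMeasurable
  · rw [norm_smul, fourier_apply, Circle.norm_coe, one_mul]
    exact hC _ (toCircle_mul_mem_ball (radius_nonneg j) (radius_lt_one j) θ)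
  · filter_upwards [h.tendsto_radius] with θ hθ using hθ.const_smul _

theorem fourierCoeff_natCast (h : HasBoundary φ g) {a : ℕ → ℂ}
    (ha : ∀ z ∈ ball (0 : ℂ) 1, HasSum (fun n => a n * z ^ n) (φ z)) (n : ℕ) :
    fourierCoeff g (n : ℤ) = a n := by
  refine tendsto_nhds_unique (h.tendsto_fourierCoeff n) ?_
  have e : ∀ j : ℕ, fourierCoeff (fun θ : UnitAddCircle =>
      φ (radius j * (AddCircle.toCircle θ : ℂ))) (n : ℤ) = a n * (radius j : ℂ) ^ n := by
    intro j
    refine (hasSum_fourierCoeff_radial ha (radius_nonneg j) (radius_lt_one j) n).unique ?_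
    have h1 := hasSum_single (f := fun k : ℕ =>
      a k * (radius j : ℂ) ^ k * (Pi.single (k : ℤ) (1 : ℂ) : ℤ → ℂ) (n : ℤ)) n fun k hk => by
        rw [Pi.single_eq_of_ne (by exact_mod_cast hk.symm), mul_zero]
    simpa using h1
  simp only [e]
  have h1 : Tendsto (fun j : ℕ => (radius j : ℂ)) atTop (𝓝 ((1 : ℝ) : ℂ)) :=
    (Complex.continuous_ofReal.tendsto 1).comp tendsto_radius'
  have h2 := (h1.pow n).const_mul (a n)
  simpa using h2

theorem exists_hasSum (h : HasBoundary φ g) :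
    ∃ a : ℕ → ℂ, ∀ z ∈ ball (0 : ℂ) 1, HasSum (fun n => a n * z ^ n) (φ z) := by
  refine ⟨fun n => ((n.factorial : ℂ))⁻¹ * iteratedDeriv n φ 0, fun z hz => ?_⟩
  have h1 := Complex.hasSum_taylorSeries_on_ball h.differentiableOn hz
  refine h1.congr_fun fun n => ?_
  simp only [smul_eq_mul, sub_zero]
  ring

theorem fourierCoeff_neg (h : HasBoundary φ g) (n : ℕ) :
    fourierCoeff g (-((n : ℤ) + 1)) = 0 := by
  obtain ⟨a, ha⟩ := h.exists_hasSum
  refine tendsto_nhds_unique (h.tendsto_fourierCoeff _) ?_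
  have e : ∀ j : ℕ, fourierCoeff (fun θ : UnitAddCircle =>
      φ (radius j * (AddCircle.toCircle θ : ℂ))) (-((n : ℤ) + 1)) = 0 := by
    intro j
    refine (hasSum_fourierCoeff_radial ha (radius_nonneg j) (radius_lt_one j) _).unique ?_
    convert! hasSum_zero using 1
    funext k
    rw [Pi.single_eq_of_ne (by omega), mul_zero]
  simp only [e]
  exact tendsto_const_nhds

theorem hasSum_fourierCoeff (h : HasBoundary φ g) {z : ℂ} (hz : z ∈ ball (0 : ℂ) 1) :
    HasSum (fun n : ℕ => fourierCoeff g (n : ℤ) * z ^ n) (φ z) := by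
  obtain ⟨a, ha⟩ := h.exists_hasSum
  simpa only [h.fourierCoeff_natCast ha] using ha z hz

theorem mul (h : HasBoundary φ g) (h' : HasBoundary ψ k) :
    HasBoundary (fun z => φ z * ψ z) (fun θ => g θ * k θ) := by
  obtain ⟨C, hC⟩ := h.bounded
  obtain ⟨D, hD⟩ := h'.bounded
  refine ⟨h.differentiableOn.mul h'.differentiableOn, ⟨C * D, fun z hz => ?_⟩, ?_⟩
  · rw [norm_mul]
    exact mul_le_mul (hC z hz) (hD z hz) (norm_nonneg _) ((norm_nonneg _).trans (hC z hz))
  · filter_upwards [h.radial, h'.radial] with θ h1 h2 using h1.mul h2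

theorem const_sub (h : HasBoundary φ g) (c : ℂ) :
    HasBoundary (fun z => c - φ z) (fun θ => c - g θ) := by
  obtain ⟨C, hC⟩ := h.bounded
  refine ⟨h.differentiableOn.const_sub c, ⟨‖c‖ + C, fun z hz => ?_⟩, ?_⟩
  · exact (norm_sub_le _ _).trans (by gcongr; exact hC z hz)
  · filter_upwards [h.radial] with θ h1 using h1.const_sub c

theorem const_mul (h : HasBoundary φ g) (c : ℂ) :
    HasBoundary (fun z => c * φ z) (fun θ => c * g θ) := by
  obtain ⟨C, hC⟩ := h.bounded
  refine ⟨h.differentiableOn.const_mul c, ⟨‖c‖ * C, fun z hz => ?_⟩, ?_⟩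
  · rw [norm_mul]
    gcongr
    exact hC z hz
  · filter_upwards [h.radial] with θ h1 using h1.const_mul c

theorem of_continuousOn (h : DifferentiableOn ℂ φ (ball 0 1))
    (hc : ContinuousOn φ (closedBall 0 1)) :
    HasBoundary φ fun θ => φ (AddCircle.toCircle θ : ℂ) := by
  refine ⟨h, ?_, Eventually.of_forall fun θ => ?_⟩
  · obtain ⟨C, hC⟩ := (isCompact_closedBall (0 : ℂ) 1).exists_bound_of_continuousOn hc
    exact ⟨C, fun z hz => hC z (ball_subset_closedBall hz)⟩
  · have h1 : ContinuousWithinAt φ (closedBall 0 1) (AddCircle.toCircle θ : ℂ) :=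
      hc _ (by rw [mem_closedBall_zero_iff, Circle.norm_coe])
    refine h1.tendsto.comp (tendsto_nhdsWithin_iff.2 ⟨?_, ?_⟩)
    · have : Tendsto (fun r : ℝ => (r : ℂ) * (AddCircle.toCircle θ : ℂ)) (𝓝 1)
          (𝓝 (((1 : ℝ) : ℂ) * (AddCircle.toCircle θ : ℂ))) :=
        (by fun_prop : Continuous fun r : ℝ => (r : ℂ) * (AddCircle.toCircle θ : ℂ)).tendsto 1
      rw [Complex.ofReal_one, one_mul] at this
      exact this.mono_left nhdsWithin_le_nhds
    · filter_upwards [Ioo_mem_nhdsLT (zero_lt_one' ℝ)] with r hr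
      exact ball_subset_closedBall (toCircle_mul_mem_ball hr.1.le hr.2 θ)

theorem pow (n : ℕ) : HasBoundary (fun z => z ^ n) fun θ => fourier (n : ℤ) θ := by
  simp only [fourier_natCast]
  exact of_continuousOn (φ := fun z => z ^ n) (by fun_prop) (by fun_prop)

end HasBoundary

/-! ### Fourier coefficients and the Hardy space -/

theorem inner_fourierLp (n : ℤ) (f : LTwo) :
    ⟪(fourierLp 2 n : LTwo), f⟫_ℂ = fourierCoeff (f : UnitAddCircle → ℂ) n := by
  rw [← fourierBasis_repr, HilbertBasis.repr_apply_apply, coe_fourierBasis]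

theorem mem_hardy_iff {f : LTwo} :
    f ∈ hardy ↔ ∀ n : ℕ, fourierCoeff (f : UnitAddCircle → ℂ) (-((n : ℤ) + 1)) = 0 := by
  rw [hardy, Submodule.mem_orthogonal]
  constructor
  · intro h n
    rw [← inner_fourierLp]
    exact h _ (Submodule.subset_span ⟨n, rfl⟩)
  · intro h u hu
    induction hu using Submodule.span_induction with
    | mem x hx =>
      obtain ⟨n, rfl⟩ := hx
      rw [inner_fourierLp]
      exact h n
    | zero => exact inner_zero_left _
    | add x y _ _ hx hy => rw [inner_add_left, hx, hy, add_zero]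
    | smul c x _ hx => rw [inner_smul_left, hx, mul_zero]

theorem exists_neg_of_not_mem_range {m : ℤ} (hm : m ∉ Set.range ((↑) : ℕ → ℤ)) :
    ∃ n : ℕ, m = -((n : ℤ) + 1) := by
  have : m < 0 := by
    by_contra h
    exact hm ⟨m.toNat, Int.toNat_of_nonneg (not_lt.1 h)⟩
  exact ⟨(-m - 1).toNat, by omega⟩

theorem hasSum_fourierLp_of_mem_hardy {f : LTwo} (hf : f ∈ hardy) :
    HasSum (fun n : ℕ => fourierCoeff (f : UnitAddCircle → ℂ) (n : ℤ) •
      (fourierLp 2 (n : ℤ) : LTwo)) f := by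
  refine (Nat.cast_injective.hasSum_iff (g := ((↑) : ℕ → ℤ)) fun m hm => ?_).2
    (hasSum_fourier_series_L2 f)
  obtain ⟨n, rfl⟩ := exists_neg_of_not_mem_range hm
  rw [mem_hardy_iff.1 hf n, zero_smul]

namespace HasBoundary

variable {φ ψ : ℂ → ℂ} {g k : UnitAddCircle → ℂ}

/-- The boundary function of a bounded analytic function, as an element of `L²`. -/
def toLTwo (h : HasBoundary φ g) : LTwo := h.memLp_two.toLp g

theorem coeFn_toLTwo (h : HasBoundary φ g) :
    (h.toLTwo : UnitAddCircle → ℂ) =ᵐ[AddCircle.haarAddCircle] g := h.memLp_two.coeFn_toLp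

theorem fourierCoeff_toLTwo (h : HasBoundary φ g) :
    fourierCoeff (h.toLTwo : UnitAddCircle → ℂ) = fourierCoeff g :=
  fourierCoeff_congr_ae h.coeFn_toLTwo

theorem toLTwo_mem_hardy (h : HasBoundary φ g) : h.toLTwo ∈ hardy :=
  mem_hardy_iff.2 fun n => by rw [h.fourierCoeff_toLTwo, h.fourierCoeff_neg]

theorem discExtension_toLTwo (h : HasBoundary φ g) {z : ℂ} (hz : z ∈ ball (0 : ℂ) 1) :
    discExtension h.toLTwo z = φ z := by
  rw [discExtension, h.fourierCoeff_toLTwo]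
  exact (h.hasSum_fourierCoeff hz).tsum_eq

/-- Multiplication by the boundary function of a bounded analytic function. -/
def mulL (h : HasBoundary φ g) : LTwo →L[ℂ] LTwo :=
  (ContinuousLinearMap.mul ℂ ℂ).holderL AddCircle.haarAddCircle ∞ 2 2 (h.memLp_top.toLp g)

theorem coeFn_mulL (h : HasBoundary φ g) (f : LTwo) :
    (h.mulL f : UnitAddCircle → ℂ) =ᵐ[AddCircle.haarAddCircle]
      fun θ => g θ * (f : UnitAddCircle → ℂ) θ := by
  have h1 := (ContinuousLinearMap.mul ℂ ℂ).coeFn_holder (r := 2) (h.memLp_top.toLp g) f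
  filter_upwards [h1, h.memLp_top.coeFn_toLp] with θ h2 h3
  rw [h3] at h2
  exact h2

theorem mulL_fourierLp (h : HasBoundary φ g) (n : ℕ) :
    h.mulL (fourierLp 2 (n : ℤ)) = (h.mul (.pow n)).toLTwo := by
  refine Lp.ext ?_
  filter_upwards [h.coeFn_mulL (fourierLp 2 (n : ℤ)), (h.mul (.pow n)).coeFn_toLTwo,
    coeFn_fourierLp 2 (n : ℤ)] with θ h1 h2 h3
  rw [h1, h2, h3]

/-- A polynomial times `φ` is again bounded analytic; the general case follows because `hardy` is
closed and polynomials approximate `f`. -/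
theorem mulL_mem_hardy (h : HasBoundary φ g) {f : LTwo} (hf : f ∈ hardy) : h.mulL f ∈ hardy := by
  have hs := h.mulL.hasSum (hasSum_fourierLp_of_mem_hardy hf)
  refine (Submodule.isClosed_orthogonal _).mem_of_tendsto hs (Eventually.of_forall fun s => ?_)
  refine Submodule.sum_mem _ fun n _ => ?_
  rw [map_smul, mulL_fourierLp]
  exact Submodule.smul_mem _ _ (toLTwo_mem_hardy _)

end HasBoundary

/-! ### The Szegő kernel -/

theorem one_sub_conj_mul_ne_zero {w u : ℂ} (hw : w ∈ ball (0 : ℂ) 1)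
    (hu : u ∈ closedBall (0 : ℂ) 1) : 1 - conj w * u ≠ 0 := by
  rw [mem_ball_zero_iff] at hw
  rw [mem_closedBall_zero_iff] at hu
  intro h
  have h1 : ‖conj w * u‖ = 1 := by rw [← sub_eq_zero.1 h, norm_one]
  rw [norm_mul, RCLike.norm_conj] at h1
  nlinarith [norm_nonneg w, norm_nonneg u]

theorem hasBoundary_szego {w : ℂ} (hw : w ∈ ball (0 : ℂ) 1) :
    HasBoundary (fun u => (1 - conj w * u)⁻¹)
      fun θ => (1 - conj w * (AddCircle.toCircle θ : ℂ))⁻¹ := by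
  refine HasBoundary.of_continuousOn (φ := fun u => (1 - conj w * u)⁻¹) ?_ ?_
  · exact DifferentiableOn.fun_inv (by fun_prop) fun u hu =>
      one_sub_conj_mul_ne_zero hw (ball_subset_closedBall hu)
  · exact ContinuousOn.inv₀ (by fun_prop) fun u hu => one_sub_conj_mul_ne_zero hw hu

/-- The Szegő kernel `τ ↦ 1 / (1 - conj w τ)`. -/
def szego {w : ℂ} (hw : w ∈ ball (0 : ℂ) 1) : LTwo := (hasBoundary_szego hw).toLTwo

theorem szego_mem_hardy {w : ℂ} (hw : w ∈ ball (0 : ℂ) 1) : szego hw ∈ hardy :=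
  (hasBoundary_szego hw).toLTwo_mem_hardy

theorem fourierCoeff_szego {w : ℂ} (hw : w ∈ ball (0 : ℂ) 1) (n : ℕ) :
    fourierCoeff (szego hw : UnitAddCircle → ℂ) (n : ℤ) = conj w ^ n := by
  rw [szego, HasBoundary.fourierCoeff_toLTwo]
  refine (hasBoundary_szego hw).fourierCoeff_natCast (a := fun n => conj w ^ n) (fun z hz => ?_) n
  simp only [← mul_pow]
  refine hasSum_geometric_of_norm_lt_one ?_
  rw [mem_ball_zero_iff] at hw hz
  rw [norm_mul, RCLike.norm_conj]
  nlinarith [norm_nonneg w, norm_nonneg z]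

theorem hasSum_inner_szego {w : ℂ} (hw : w ∈ ball (0 : ℂ) 1) (f : LTwo) :
    HasSum (fun n : ℕ => fourierCoeff (f : UnitAddCircle → ℂ) (n : ℤ) * w ^ n) ⟪szego hw, f⟫_ℂ := by
  have h := fourierBasis.hasSum_inner_mul_inner (szego hw) f
  simp only [coe_fourierBasis, inner_fourierLp] at h
  rw [← Nat.cast_injective.hasSum_iff (g := ((↑) : ℕ → ℤ))] at h
  · refine h.congr_fun fun n => ?_
    rw [Function.comp_apply, ← inner_conj_symm, inner_fourierLp, fourierCoeff_szego, map_pow,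
      Complex.conj_conj, mul_comm]
  · intro m hm
    obtain ⟨n, rfl⟩ := exists_neg_of_not_mem_range hm
    rw [← inner_conj_symm, inner_fourierLp,
      mem_hardy_iff.1 (szego_mem_hardy hw) n, map_zero, zero_mul]

theorem inner_szego {w : ℂ} (hw : w ∈ ball (0 : ℂ) 1) (f : LTwo) :
    ⟪szego hw, f⟫_ℂ = discExtension f w := (hasSum_inner_szego hw f).tsum_eq.symm

theorem hasSum_discExtension (f : LTwo) {z : ℂ} (hz : z ∈ ball (0 : ℂ) 1) :
    HasSum (fun n : ℕ => fourierCoeff (f : UnitAddCircle → ℂ) (n : ℤ) * z ^ n)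
      (discExtension f z) := inner_szego hz f ▸ hasSum_inner_szego hz f

theorem continuousOn_discExtension (f : LTwo) : ContinuousOn (discExtension f) (ball 0 1) := by
  intro z hz
  obtain ⟨r, hzr, hr⟩ := exists_between (mem_ball_zero_iff.1 hz)
  have hr0 : 0 ≤ r := (norm_nonneg z).trans hzr.le
  have hr' : (r : ℂ) ∈ ball (0 : ℂ) 1 := by
    rwa [mem_ball_zero_iff, Complex.norm_real, Real.norm_of_nonneg hr0]
  have hc : ContinuousOn (discExtension f) (ball 0 r) := by
    refine continuousOn_tsum (fun n => by fun_prop) (hasSum_discExtension f hr').summable.norm ?_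
    intro n u hu
    rw [norm_mul, norm_mul, norm_pow, norm_pow, Complex.norm_real, Real.norm_of_nonneg hr0]
    gcongr
    exact (mem_ball_zero_iff.1 hu).le
  exact (hc.continuousAt (isOpen_ball.mem_nhds (mem_ball_zero_iff.2 hzr))).continuousWithinAt

theorem HasBoundary.discExtension_mulL {φ : ℂ → ℂ} {g : UnitAddCircle → ℂ} (h : HasBoundary φ g)
    {f : LTwo} (hf : f ∈ hardy) {z : ℂ} (hz : z ∈ ball (0 : ℂ) 1) :
    discExtension (h.mulL f) z = φ z * discExtension f z := by
  have h1 := ((innerSL ℂ (szego hz)).comp h.mulL).hasSum (hasSum_fourierLp_of_mem_hardy hf)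
  have h2 := (hasSum_discExtension f hz).mul_left (φ z)
  rw [← inner_szego hz]
  refine h1.unique (h2.congr_fun fun n => ?_)
  rw [map_smul, ContinuousLinearMap.comp_apply, h.mulL_fourierLp, innerSL_apply_apply,
    inner_szego, HasBoundary.discExtension_toLTwo _ hz, smul_eq_mul]
  ring

theorem eq_zero_of_discExtension_eq_zero {f : LTwo} (hf : f ∈ hardy)
    (h : ∀ z ∈ ball (0 : ℂ) 1, discExtension f z = 0) : f = 0 := by
  have h0 : HasBoundary (fun _ => 0) fun _ => 0 :=
    HasBoundary.of_continuousOn (φ := fun _ => 0) (by fun_prop) (by fun_prop)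
  have hc : ∀ n : ℕ, fourierCoeff (f : UnitAddCircle → ℂ) (n : ℤ) = 0 := by
    intro n
    rw [← h0.fourierCoeff_natCast (a := fun n : ℕ => fourierCoeff (f : UnitAddCircle → ℂ) (n : ℤ))
      (fun z hz => h z hz ▸ hasSum_discExtension f hz)]
    simp [fourierCoeff]
  refine (hasSum_fourierLp_of_mem_hardy hf).unique ?_
  simp only [hc, zero_smul]
  exact hasSum_zero

theorem eq_of_discExtension_eq {f g : LTwo} (hf : f ∈ hardy) (hg : g ∈ hardy)
    (h : ∀ z ∈ ball (0 : ℂ) 1, discExtension f z = discExtension g z) : f = g := by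
  refine sub_eq_zero.1 (eq_zero_of_discExtension_eq_zero (Submodule.sub_mem _ hf hg) fun z hz => ?_)
  rw [← inner_szego hz, inner_sub_right, inner_szego, inner_szego, h z hz, sub_self]

/-! ### Nontangential limits -/

theorem stolzAngle_subset_ball (M : ℝ) (ζ : ℂ) : stolzAngle M ζ ⊆ ball 0 1 := fun _ hz =>
  mem_ball_zero_iff.2 hz.1

theorem tendsto_radial_stolzAngle {ζ : ℂ} (hζ : ‖ζ‖ = 1) :
    Tendsto (fun r : ℝ => (r : ℂ) * ζ) (𝓝[<] 1) (𝓝[stolzAngle 2 ζ] ζ) := by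
  refine tendsto_nhdsWithin_iff.2 ⟨?_, ?_⟩
  · have h : Tendsto (fun r : ℝ => (r : ℂ) * ζ) (𝓝 1) (𝓝 (((1 : ℝ) : ℂ) * ζ)) :=
      (by fun_prop : Continuous fun r : ℝ => (r : ℂ) * ζ).tendsto 1
    rw [Complex.ofReal_one, one_mul] at h
    exact h.mono_left nhdsWithin_le_nhds
  · filter_upwards [Ioo_mem_nhdsLT (zero_lt_one' ℝ)] with r hr
    have h1 : ‖(r : ℂ) * ζ‖ = r := by
      rw [norm_mul, hζ, mul_one, Complex.norm_real, Real.norm_of_nonneg hr.1.le]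
    have h2 : ‖(r : ℂ) * ζ - ζ‖ = 1 - r := by
      have e : (r : ℂ) * ζ - ζ = ((r - 1 : ℝ) : ℂ) * ζ := by push_cast; ring
      rw [e, norm_mul, hζ, mul_one, Complex.norm_real, Real.norm_eq_abs,
        abs_of_neg (by linarith [hr.2])]
      ring
    refine ⟨by rw [h1]; exact hr.2, ?_⟩
    rw [h1, h2]
    linarith [hr.2]

namespace HasNTLimit

variable {F G : ℂ → ℂ} {ζ c : ℂ}

theorem radial (h : HasNTLimit F ζ c) (hζ : ‖ζ‖ = 1) :
    Tendsto (fun r : ℝ => F (r * ζ)) (𝓝[<] 1) (𝓝 c) :=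
  (h 2).comp (tendsto_radial_stolzAngle hζ)

theorem value_eq (h : HasNTLimit F ζ c) (hζ : ‖ζ‖ = 1) : value F ζ = c := by
  have hex : ∃ c, HasNTLimit F ζ c := ⟨c, h⟩
  rw [value, if_neg hζ.not_lt, dif_pos hex]
  exact hex.choose_spec.unique hζ h

theorem congr (h : HasNTLimit F ζ c) (hFG : ∀ z ∈ ball (0 : ℂ) 1, F z = G z) :
    HasNTLimit G ζ c := fun M =>
  (h M).congr' (eventually_mem_nhdsWithin.mono fun z hz => hFG z (stolzAngle_subset_ball M ζ hz))

theorem of_continuousAt (h : ContinuousAt F ζ) : HasNTLimit F ζ (F ζ) := fun _ =>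
  h.tendsto.mono_left nhdsWithin_le_nhds

end HasNTLimit

theorem value_of_mem_ball {F : ℂ → ℂ} {z : ℂ} (hz : z ∈ ball (0 : ℂ) 1) : value F z = F z :=
  if_pos (mem_ball_zero_iff.1 hz)

/-! ### Reproducing kernels of the model space in the disc -/

namespace IsInner

variable {Θ : ℂ → ℂ}

theorem hasBoundary (hΘ : IsInner Θ) :
    HasBoundary Θ fun θ => value Θ (AddCircle.toCircle θ : ℂ) := by
  refine ⟨hΘ.differentiableOn, hΘ.bounded, ?_⟩
  filter_upwards [hΘ.unimodular] with θ hθ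
  obtain ⟨c, -, hc⟩ := hθ
  rw [hc.value_eq (Circle.norm_coe _)]
  exact hc.radial (Circle.norm_coe _)

theorem ae_norm_value (hΘ : IsInner Θ) : ∀ᵐ θ : UnitAddCircle ∂AddCircle.haarAddCircle,
    ‖value Θ (AddCircle.toCircle θ : ℂ)‖ = 1 := by
  filter_upwards [hΘ.unimodular] with θ hθ
  obtain ⟨c, h1, hc⟩ := hθ
  rw [hc.value_eq (Circle.norm_coe _), h1]

/-- Needed because `Θ` can be recovered from the kernel at `w` only when `Θ w ≠ 0`. -/
theorem exists_ne_zero (hΘ : IsInner Θ) : ∃ w ∈ ball (0 : ℂ) 1, Θ w ≠ 0 := by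
  obtain ⟨θ, h1, h2⟩ := (hΘ.ae_norm_value.and hΘ.hasBoundary.tendsto_radius).exists
  by_contra! h
  have h3 := tendsto_nhds_unique h2 (tendsto_const_nhds.congr fun n =>
    (h _ (toCircle_mul_mem_ball (radius_nonneg n) (radius_lt_one n) θ)).symm)
  rw [h3, norm_zero] at h1
  exact zero_ne_one h1

theorem inner_mulL_mulL (hΘ : IsInner Θ) (f g : LTwo) :
    ⟪hΘ.hasBoundary.mulL f, hΘ.hasBoundary.mulL g⟫_ℂ = ⟪f, g⟫_ℂ := by
  rw [L2.inner_def, L2.inner_def]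
  refine integral_congr_ae ?_
  filter_upwards [hΘ.hasBoundary.coeFn_mulL f, hΘ.hasBoundary.coeFn_mulL g,
    hΘ.ae_norm_value] with θ h1 h2 h3
  have h4 := Complex.mul_conj (value Θ (AddCircle.toCircle θ : ℂ))
  rw [Complex.normSq_eq_norm_sq, h3, one_pow, Complex.ofReal_one] at h4
  simp only [h1, h2, RCLike.inner_apply, map_mul]
  linear_combination
    (g : UnitAddCircle → ℂ) θ * conj ((f : UnitAddCircle → ℂ) θ) * h4

theorem mulL_mem_innerMultiples (hΘ : IsInner Θ) {f : LTwo} (hf : f ∈ hardy) :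
    hΘ.hasBoundary.mulL f ∈ innerMultiples Θ :=
  ⟨f, hf, hΘ.hasBoundary.coeFn_mulL f⟩

theorem eq_mulL_of_mem_innerMultiples (hΘ : IsInner Θ) {F : LTwo} (hF : F ∈ innerMultiples Θ) :
    ∃ g ∈ hardy, F = hΘ.hasBoundary.mulL g := by
  obtain ⟨g, hg, h⟩ := hF
  exact ⟨g, hg, Lp.ext (h.trans (hΘ.hasBoundary.coeFn_mulL g).symm)⟩

theorem hasBoundary_kernel (hΘ : IsInner Θ) {w : ℂ} (hw : w ∈ ball (0 : ℂ) 1) :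
    HasBoundary (fun u => (1 - conj (Θ w) * Θ u) * (1 - conj w * u)⁻¹) (kernel Θ w) := by
  have h := ((hΘ.hasBoundary.const_mul (conj (Θ w))).const_sub 1).mul (hasBoundary_szego hw)
  have e : kernel Θ w = fun θ : UnitAddCircle =>
      (1 - conj (Θ w) * value Θ (AddCircle.toCircle θ : ℂ)) *
        (1 - conj w * (AddCircle.toCircle θ : ℂ))⁻¹ := by
    funext θ
    rw [kernel, value_of_mem_ball hw, div_eq_mul_inv]
  rw [e]
  exact h

theorem toLTwo_kernel (hΘ : IsInner Θ) {w : ℂ} (hw : w ∈ ball (0 : ℂ) 1) :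
    (hΘ.hasBoundary_kernel hw).toLTwo =
      szego hw - conj (Θ w) • hΘ.hasBoundary.mulL (szego hw) := by
  refine Lp.ext ?_
  filter_upwards [(hΘ.hasBoundary_kernel hw).coeFn_toLTwo,
    Lp.coeFn_sub (szego hw) (conj (Θ w) • hΘ.hasBoundary.mulL (szego hw)),
    Lp.coeFn_smul (conj (Θ w)) (hΘ.hasBoundary.mulL (szego hw)),
    hΘ.hasBoundary.coeFn_mulL (szego hw), (hasBoundary_szego hw).coeFn_toLTwo]
    with θ h1 h2 h3 h4 h5
  rw [h1, h2, Pi.sub_apply, h3, Pi.smul_apply, h4, szego, h5, kernel, value_of_mem_ball hw,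
    smul_eq_mul]
  ring

theorem toLTwo_kernel_mem (hΘ : IsInner Θ) {w : ℂ} (hw : w ∈ ball (0 : ℂ) 1) :
    (hΘ.hasBoundary_kernel hw).toLTwo ∈ modelSpace Θ := by
  refine ⟨HasBoundary.toLTwo_mem_hardy _, ?_⟩
  rw [SetLike.mem_coe, Submodule.mem_orthogonal']
  intro u hu
  induction hu using Submodule.span_induction with
  | mem x hx =>
    obtain ⟨g, hg, rfl⟩ := hΘ.eq_mulL_of_mem_innerMultiples hx
    -- Both terms equal `Θ(w) g(w)`: the first by the Szegő kernel applied to `Θg`, the second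
    -- because multiplication by `Θ` is isometric.
    rw [hΘ.toLTwo_kernel hw, inner_sub_left, inner_smul_left, hΘ.inner_mulL_mulL, inner_szego,
      inner_szego,
      hΘ.hasBoundary.discExtension_mulL hg hw, Complex.conj_conj, sub_self]
  | zero => exact inner_zero_right _
  | add x y _ _ hx hy => rw [inner_add_right, hx, hy, add_zero]
  | smul c x _ hx => rw [inner_smul_right, hx, mul_zero]

/-- The reproducing kernel of the model space at a point of the disc. -/
def modelKernel (hΘ : IsInner Θ) {w : ℂ} (hw : w ∈ ball (0 : ℂ) 1) : modelSpace Θ :=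
  ⟨_, hΘ.toLTwo_kernel_mem hw⟩

theorem inner_modelKernel (hΘ : IsInner Θ) {w : ℂ} (hw : w ∈ ball (0 : ℂ) 1)
    (f : modelSpace Θ) : ⟪hΘ.modelKernel hw, f⟫_ℂ = discExtension f w := by
  change ⟪(hΘ.hasBoundary_kernel hw).toLTwo, (f : LTwo)⟫_ℂ = _
  have h0 : ⟪hΘ.hasBoundary.mulL (szego hw), (f : LTwo)⟫_ℂ = 0 :=
    (Submodule.mem_orthogonal _ _).1 f.2.2 _
      (Submodule.subset_span (hΘ.mulL_mem_innerMultiples (szego_mem_hardy hw)))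
  rw [hΘ.toLTwo_kernel hw, inner_sub_left, inner_smul_left, h0, mul_zero, sub_zero, inner_szego]

theorem discExtension_modelKernel (hΘ : IsInner Θ) {w u : ℂ} (hw : w ∈ ball (0 : ℂ) 1)
    (hu : u ∈ ball (0 : ℂ) 1) : discExtension (hΘ.modelKernel hw : LTwo) u =
      (1 - conj (Θ w) * Θ u) * (1 - conj w * u)⁻¹ :=
  (hΘ.hasBoundary_kernel hw).discExtension_toLTwo hu

theorem norm_modelKernel_sq (hΘ : IsInner Θ) {w : ℂ} (hw : w ∈ ball (0 : ℂ) 1) :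
    ‖hΘ.modelKernel hw‖ ^ 2 = (1 - ‖Θ w‖ ^ 2) / (1 - ‖w‖ ^ 2) := by
  have h := inner_self_eq_norm_sq_to_K (𝕜 := ℂ) (hΘ.modelKernel hw)
  rw [inner_modelKernel, discExtension_modelKernel hΘ hw hw, ← Complex.normSq_eq_conj_mul_self,
    ← Complex.normSq_eq_conj_mul_self, Complex.normSq_eq_norm_sq, Complex.normSq_eq_norm_sq] at h
  rw [div_eq_mul_inv]
  apply Complex.ofReal_injective
  push_cast at h ⊢
  exact h.symm

/-- Positivity of `‖k_w‖²` replaces the maximum principle. -/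
theorem norm_le_one (hΘ : IsInner Θ) {w : ℂ} (hw : w ∈ ball (0 : ℂ) 1) : ‖Θ w‖ ≤ 1 := by
  have h := hΘ.norm_modelKernel_sq hw
  rw [mem_ball_zero_iff] at hw
  have h1 : 0 < 1 - ‖w‖ ^ 2 := by nlinarith [norm_nonneg w]
  rw [eq_div_iff h1.ne'] at h
  have h2 : 0 ≤ ‖hΘ.modelKernel (mem_ball_zero_iff.2 hw)‖ ^ 2 * (1 - ‖w‖ ^ 2) := by positivity
  nlinarith [norm_nonneg (Θ w)]

theorem norm_discExtension_le (hΘ : IsInner Θ) {w : ℂ} (hw : w ∈ ball (0 : ℂ) 1)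
    (f : modelSpace Θ) : ‖discExtension f w‖ ≤ ‖hΘ.modelKernel hw‖ * ‖f‖ := by
  rw [← hΘ.inner_modelKernel hw]
  exact norm_inner_le_norm (𝕜 := ℂ) (hΘ.modelKernel hw) f

theorem kernelNorm_of_mem_ball (hΘ : IsInner Θ) {w : ℂ} (hw : w ∈ ball (0 : ℂ) 1) :
    kernelNorm Θ w = ‖hΘ.modelKernel hw‖ₑ := by
  rw [kernelNorm, if_pos (Or.inl (mem_ball_zero_iff.1 hw)),
    ← eLpNorm_congr_ae (hΘ.hasBoundary_kernel hw).coeFn_toLTwo]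
  exact (Lp.enorm_def _).symm

theorem topologicalClosure_span_modelKernel (hΘ : IsInner Θ) :
    (Submodule.span ℂ (Set.range fun w : ball (0 : ℂ) 1 => hΘ.modelKernel w.2)).topologicalClosure
      = ⊤ := by
  rw [Submodule.topologicalClosure_eq_top_iff, Submodule.eq_bot_iff]
  intro f hf
  refine Subtype.ext (eq_zero_of_discExtension_eq_zero f.2.1 fun z hz => ?_)
  rw [← hΘ.inner_modelKernel hz]
  exact (Submodule.mem_orthogonal _ _).1 hf _ (Submodule.subset_span ⟨⟨z, hz⟩, rfl⟩)

end IsInner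

/-! ### Reproducing kernels of the model space on the circle -/

instance : NullSingletonClass (AddCircle.haarAddCircle : Measure UnitAddCircle) := by
  have : Nontrivial UnitAddCircle := by
    refine ⟨((1 / 2 : ℝ) : UnitAddCircle), 0, fun h => ?_⟩
    obtain ⟨n, hn⟩ := (AddCircle.coe_eq_zero_iff (1 : ℝ)).1 h
    rw [zsmul_eq_mul, mul_one] at hn
    have h2 : ((2 * n : ℤ) : ℝ) = ((1 : ℤ) : ℝ) := by push_cast; linarith
    have := Int.cast_injective h2
    omega
  infer_instance

theorem ae_one_sub_conj_mul_toCircle_ne_zero (z : ℂ) :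
    ∀ᵐ θ : UnitAddCircle ∂AddCircle.haarAddCircle,
      1 - conj z * (AddCircle.toCircle θ : ℂ) ≠ 0 := by
  have hs : {θ : UnitAddCircle | 1 - conj z * (AddCircle.toCircle θ : ℂ) = 0}.Subsingleton := by
    intro θ hθ η hη
    refine AddCircle.injective_toCircle one_ne_zero (Circle.ext ?_)
    have h1 := sub_eq_zero.1 hθ
    have h2 := sub_eq_zero.1 hη
    refine mul_left_cancel₀ (left_ne_zero_of_mul (h1 ▸ one_ne_zero)) (h1.symm.trans h2)
  rw [ae_iff]
  simpa only [ne_eq, not_not] using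
    hs.measure_zero (AddCircle.haarAddCircle : Measure UnitAddCircle)

/-- `κ` reproduces the nontangential limits at `z` of the functions in the model space. -/
def IsReproducing (Θ : ℂ → ℂ) (z : ℂ) (κ : modelSpace Θ) : Prop :=
  ∀ f : modelSpace Θ, HasNTLimit (discExtension f) z ⟪κ, f⟫_ℂ

theorem one_sub_conj_mul_ne_zero' {w z : ℂ} (hw : w ∈ ball (0 : ℂ) 1) (hz : ‖z‖ = 1) :
    1 - conj w * z ≠ 0 :=
  one_sub_conj_mul_ne_zero hw (mem_closedBall_zero_iff.2 hz.le)

namespace IsInner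

variable {Θ : ℂ → ℂ}

theorem hasNTLimit_modelKernel (hΘ : IsInner Θ) {z c w : ℂ} (hz : ‖z‖ = 1) (hc : HasNTLimit Θ z c)
    (hw : w ∈ ball (0 : ℂ) 1) : HasNTLimit (discExtension (hΘ.modelKernel hw : LTwo)) z
      ((1 - conj (Θ w) * c) * (1 - conj w * z)⁻¹) := by
  refine HasNTLimit.congr (F := fun u => (1 - conj (Θ w) * Θ u) * (1 - conj w * u)⁻¹) ?_
    fun u hu => (hΘ.discExtension_modelKernel hw hu).symm
  intro M
  have h1 : ContinuousAt (fun u => (1 - conj w * u)⁻¹) z :=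
    ContinuousAt.inv₀ (by fun_prop) (one_sub_conj_mul_ne_zero' hw hz)
  exact (((hc M).const_mul _).const_sub 1).mul (HasNTLimit.of_continuousAt h1 M)

/-- The formula for `k_w` is solved for `Θ`. -/
theorem exists_hasNTLimit (hΘ : IsInner Θ) {z L w : ℂ} (hw : w ∈ ball (0 : ℂ) 1)
    (hw0 : Θ w ≠ 0) (hL : HasNTLimit (discExtension (hΘ.modelKernel hw : LTwo)) z L) :
    ∃ c, HasNTLimit Θ z c := by
  refine ⟨(conj (Θ w))⁻¹ * (1 - L * (1 - conj w * z)), HasNTLimit.congr (F := fun u =>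
    (conj (Θ w))⁻¹ * (1 - discExtension (hΘ.modelKernel hw : LTwo) u * (1 - conj w * u))) ?_ ?_⟩
  · intro M
    have h1 : ContinuousAt (fun u => 1 - conj w * u) z := by fun_prop
    exact (((hL M).mul (HasNTLimit.of_continuousAt h1 M)).const_sub 1).const_mul _
  · intro u hu
    have h1 : conj (Θ w) ≠ 0 := (map_ne_zero _).2 hw0
    have h2 := one_sub_conj_mul_ne_zero hw (ball_subset_closedBall hu)
    rw [hΘ.discExtension_modelKernel hw hu]
    field_simp
    ring

/-- `⟪κ, k_w⟫` is on one hand the limit of `k_w` at `z`, on the other the conjugate of `κ(w)`. -/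
theorem discExtension_eq_of_inner_eq (hΘ : IsInner Θ) {z c w : ℂ} (hz : ‖z‖ = 1)
    (hc : HasNTLimit Θ z c) (hw : w ∈ ball (0 : ℂ) 1) {κ : modelSpace Θ}
    (hκ : HasNTLimit (discExtension (hΘ.modelKernel hw : LTwo)) z ⟪κ, hΘ.modelKernel hw⟫_ℂ) :
    (1 - conj z * w) * discExtension (κ : LTwo) w = 1 - conj c * Θ w := by
  have h1 := hκ.unique hz (hΘ.hasNTLimit_modelKernel hz hc hw)
  have h2 : (1 - conj w * z) * ⟪κ, hΘ.modelKernel hw⟫_ℂ = 1 - conj (Θ w) * c := by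
    rw [h1, mul_comm, mul_assoc, inv_mul_cancel₀ (one_sub_conj_mul_ne_zero' hw hz), mul_one]
  have h3 := congrArg conj h2
  rw [map_mul, inner_conj_symm (hΘ.modelKernel hw) κ, hΘ.inner_modelKernel hw] at h3
  simp only [map_sub, map_mul, map_one, Complex.conj_conj] at h3
  rw [mul_comm (conj z), h3, mul_comm (conj c)]

/-- The products of `κ` and of `k_z` with `1 - z̄τ` have the same analytic extension. This factor
vanishes at no more than one point of the circle, so `κ = k_z` almost everywhere. -/
theorem kernelNorm_of_isReproducing (hΘ : IsInner Θ) {z : ℂ} (hz : ‖z‖ = 1) {κ : modelSpace Θ}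
    (hκ : IsReproducing Θ z κ) : kernelNorm Θ z = ‖κ‖ₑ := by
  obtain ⟨w₀, hw₀, h0⟩ := hΘ.exists_ne_zero
  obtain ⟨c, hc⟩ := hΘ.exists_hasNTLimit hw₀ h0 (hκ _)
  have hP : HasBoundary (fun u => 1 - conj z * u)
      fun θ => 1 - conj z * (AddCircle.toCircle θ : ℂ) :=
    HasBoundary.of_continuousOn (φ := fun u => 1 - conj z * u) (by fun_prop) (by fun_prop)
  have hQ := (hΘ.hasBoundary.const_mul (conj c)).const_sub 1
  have heq : hP.mulL κ = hQ.toLTwo := by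
    refine eq_of_discExtension_eq (hP.mulL_mem_hardy κ.2.1) hQ.toLTwo_mem_hardy fun w hw => ?_
    rw [hP.discExtension_mulL κ.2.1 hw, hQ.discExtension_toLTwo hw]
    exact hΘ.discExtension_eq_of_inner_eq hz hc hw (hκ _)
  have hae : kernel Θ z =ᵐ[AddCircle.haarAddCircle] ((κ : LTwo) : UnitAddCircle → ℂ) := by
    have h1 := hP.coeFn_mulL (κ : LTwo)
    rw [heq] at h1
    filter_upwards [h1, hQ.coeFn_toLTwo, ae_one_sub_conj_mul_toCircle_ne_zero z] with θ h2 h3 h4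
    rw [kernel, hc.value_eq hz, ← h3, h2, mul_div_cancel_left₀ _ h4]
  rw [kernelNorm, if_pos (Or.inr fun f hf => ⟨_, hκ ⟨f, hf⟩⟩), eLpNorm_congr_ae hae]
  exact (Lp.enorm_def _).symm

/-- Radial evaluations converge pointwise, so by Banach–Steinhaus their limit is a bounded
functional, which Riesz represents. -/
theorem exists_isReproducing (hΘ : IsInner Θ) {z : ℂ} (hz : ‖z‖ = 1)
    (h : ∀ f ∈ modelSpace Θ, ∃ c, HasNTLimit (discExtension f) z c) :
    ∃ κ : modelSpace Θ, IsReproducing Θ z κ := by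
  choose! F hF using h
  have hmem : ∀ n, (radius n : ℂ) * z ∈ ball (0 : ℂ) 1 := fun n => by
    rw [mem_ball_zero_iff, norm_mul, hz, mul_one, Complex.norm_real,
      Real.norm_of_nonneg (radius_nonneg n)]
    exact radius_lt_one n
  have ht : Tendsto (fun n (f : modelSpace Θ) => innerSL ℂ (hΘ.modelKernel (hmem n)) f) atTop
      (𝓝 fun f : modelSpace Θ => F f) := by
    refine tendsto_pi_nhds.2 fun f => ?_
    simp only [innerSL_apply_apply, hΘ.inner_modelKernel]
    exact ((hF f f.2).radial hz).comp tendsto_radius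
  refine ⟨(InnerProductSpace.toDual ℂ (modelSpace Θ)).symm (continuousLinearMapOfTendsto _ ht),
    fun f => ?_⟩
  rw [InnerProductSpace.toDual_symm_apply]
  exact hF f f.2

/-- With `K = ‖k_u‖`, the chain `1 - |Θ(u)| ≤ |1 - c̄ Θ(u)| = |u - z| |κ(u)| ≤ M (1 - |u|) K ‖κ‖`
bounds `K²` by a multiple of `K`. The factor 2 comes from `1 - t² ≤ 2 (1 - t)`. -/
theorem norm_modelKernel_le (hΘ : IsInner Θ) {z c u : ℂ} {M : ℝ} (hz : ‖z‖ = 1) (hc : ‖c‖ ≤ 1)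
    {κ : modelSpace Θ} (hu : u ∈ ball (0 : ℂ) 1) (huM : u ∈ stolzAngle M z)
    (h : (1 - conj z * u) * discExtension (κ : LTwo) u = 1 - conj c * Θ u) :
    ‖hΘ.modelKernel hu‖ ≤ 2 * M * ‖κ‖ := by
  have hu1 : ‖u‖ < 1 := huM.1
  have hM : 0 < M := by
    have := (norm_nonneg _).trans_lt huM.2
    exact pos_of_mul_pos_left this (by linarith)
  have h1 := hΘ.norm_modelKernel_sq hu
  rw [eq_div_iff (by nlinarith [norm_nonneg u])] at h1
  have h2 : ‖1 - conj z * u‖ = ‖u - z‖ := by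
    have e : u - z = -(z * (1 - conj z * u)) := by
      have := Complex.mul_conj z
      rw [Complex.normSq_eq_norm_sq, hz, one_pow, Complex.ofReal_one] at this
      linear_combination -u * this
    rw [e, norm_neg, norm_mul, hz, one_mul]
  have h3 : 1 - ‖Θ u‖ ≤ ‖1 - conj c * Θ u‖ := by
    have h4 := norm_sub_norm_le 1 (conj c * Θ u)
    rw [norm_one, norm_mul, RCLike.norm_conj] at h4
    nlinarith [norm_nonneg (Θ u)]
  rw [← h, norm_mul, h2] at h3
  have h4 := hΘ.norm_discExtension_le hu κ
  have h5 := hΘ.norm_le_one hu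
  set K := ‖hΘ.modelKernel hu‖ with hK
  have hK0 : 0 ≤ K := norm_nonneg _
  have h6 : ‖u - z‖ * ‖discExtension (κ : LTwo) u‖ ≤ M * (1 - ‖u‖) * (K * ‖κ‖) :=
    mul_le_mul huM.2.le h4 (norm_nonneg _) (mul_nonneg hM.le (by linarith))
  have h7 : K ^ 2 * (1 - ‖u‖) ≤ 2 * M * ‖κ‖ * K * (1 - ‖u‖) := by
    have h8 : K ^ 2 * (1 - ‖u‖) ≤ K ^ 2 * (1 - ‖u‖ ^ 2) := by
      refine mul_le_mul_of_nonneg_left ?_ (sq_nonneg K)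
      nlinarith [norm_nonneg u]
    have h9 : 1 - ‖Θ u‖ ^ 2 ≤ 2 * (1 - ‖Θ u‖) := by nlinarith [sq_nonneg (1 - ‖Θ u‖)]
    linarith
  have h8 := le_of_mul_le_mul_right h7 (by linarith)
  rcases hK0.eq_or_lt with h0 | h0
  · rw [← h0]
    positivity
  · rw [sq] at h8
    exact le_of_mul_le_mul_right h8 h0

theorem hasNTLimit_of_mem_span (hΘ : IsInner Θ) {z : ℂ} {κ : modelSpace Θ}
    (h : ∀ (w : ℂ) (hw : w ∈ ball (0 : ℂ) 1),
      HasNTLimit (discExtension (hΘ.modelKernel hw : LTwo)) z ⟪κ, hΘ.modelKernel hw⟫_ℂ)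
    {f : modelSpace Θ} (hf : f ∈ Submodule.span ℂ
      (Set.range fun w : ball (0 : ℂ) 1 => hΘ.modelKernel w.2)) :
    HasNTLimit (discExtension (f : LTwo)) z ⟪κ, f⟫_ℂ := by
  induction hf using Submodule.span_induction with
  | mem x hx =>
    obtain ⟨w, rfl⟩ := hx
    exact h w w.2
  | zero =>
    rw [inner_zero_right]
    refine HasNTLimit.congr (F := fun _ => 0) (fun _ => tendsto_const_nhds) fun u hu => ?_
    rw [← hΘ.inner_modelKernel hu, inner_zero_right]
  | add x y _ _ hx hy =>
    rw [inner_add_right]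
    refine HasNTLimit.congr (F := fun u => discExtension (x : LTwo) u + discExtension (y : LTwo) u)
      (fun M => (hx M).add (hy M)) fun u hu => ?_
    rw [← hΘ.inner_modelKernel hu, ← hΘ.inner_modelKernel hu, ← hΘ.inner_modelKernel hu,
      inner_add_right]
  | smul c x _ hx =>
    rw [inner_smul_right]
    refine HasNTLimit.congr (F := fun u => c * discExtension (x : LTwo) u)
      (fun M => (hx M).const_mul c) fun u hu => ?_
    rw [← hΘ.inner_modelKernel hu, ← hΘ.inner_modelKernel hu, inner_smul_right]

theorem isReproducing_of_norm_modelKernel_le (hΘ : IsInner Θ) {z : ℂ} {κ : modelSpace Θ}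
    (h : ∀ (w : ℂ) (hw : w ∈ ball (0 : ℂ) 1),
      HasNTLimit (discExtension (hΘ.modelKernel hw : LTwo)) z ⟪κ, hΘ.modelKernel hw⟫_ℂ)
    (hb : ∀ (M : ℝ) (u : ℂ) (hu : u ∈ ball (0 : ℂ) 1), u ∈ stolzAngle M z →
      ‖hΘ.modelKernel hu‖ ≤ 2 * M * ‖κ‖) :
    IsReproducing Θ z κ := by
  intro f M
  rw [Metric.tendsto_nhds]
  intro ε hε
  -- `B` dominates the norms of evaluation at `u` and of `⟪κ, ·⟫` together. The absolute value
  -- covers negative `M`, and the `1` makes `B` positive.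
  set B : ℝ := |2 * M * ‖κ‖| + ‖κ‖ + 1 with hB
  have hB0 : 0 < B := by positivity
  have hf : f ∈ closure (Submodule.span ℂ
      (Set.range fun w : ball (0 : ℂ) 1 => hΘ.modelKernel w.2) : Set (modelSpace Θ)) := by
    rw [← Submodule.topologicalClosure_coe, hΘ.topologicalClosure_span_modelKernel]
    trivial
  obtain ⟨g, hg, hfg⟩ := Metric.mem_closure_iff.1 hf (ε / 2 / B) (by positivity)
  rw [dist_eq_norm, lt_div_iff₀ hB0] at hfg
  have hlim := hΘ.hasNTLimit_of_mem_span h hg M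
  filter_upwards [Metric.tendsto_nhds.1 hlim (ε / 2) (by positivity), self_mem_nhdsWithin]
    with u h1 hu
  have hu' := stolzAngle_subset_ball M z hu
  rw [dist_eq_norm] at h1 ⊢
  have e : discExtension (f : LTwo) u - ⟪κ, f⟫_ℂ =
      ⟪hΘ.modelKernel hu', f - g⟫_ℂ + (discExtension (g : LTwo) u - ⟪κ, g⟫_ℂ) - ⟪κ, f - g⟫_ℂ := by
    rw [inner_sub_right, inner_sub_right, hΘ.inner_modelKernel, hΘ.inner_modelKernel]
    ring
  have h2 : ‖⟪hΘ.modelKernel hu', f - g⟫_ℂ‖ ≤ |2 * M * ‖κ‖| * ‖f - g‖ := by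
    refine (norm_inner_le_norm (𝕜 := ℂ) (hΘ.modelKernel hu') (f - g)).trans ?_
    gcongr
    exact (hb M u hu' hu).trans (le_abs_self _)
  have h3 := norm_inner_le_norm (𝕜 := ℂ) κ (f - g)
  rw [e]
  calc _ ≤ ‖⟪hΘ.modelKernel hu', f - g⟫_ℂ‖ + ‖discExtension (g : LTwo) u - ⟪κ, g⟫_ℂ‖
        + ‖⟪κ, f - g⟫_ℂ‖ := (norm_sub_le _ _).trans (by gcongr; exact norm_add_le _ _)
    _ < ε := by nlinarith [norm_nonneg (f - g)]

/-- If a function of the model space reproduces the nontangential limits at `z` of sufficiently many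
reproducing kernels, then all functions of the model space have nontangential limits at `z`. -/
theorem isReproducing_of_dense (hΘ : IsInner Θ) {z : ℂ} (hz : ‖z‖ = 1) {κ : modelSpace Θ}
    {W : Set ℂ} (hW : W ⊆ ball 0 1) (hdense : ball (0 : ℂ) 1 ⊆ closure W)
    (h : ∀ w (hw : w ∈ W),
      HasNTLimit (discExtension (hΘ.modelKernel (hW hw) : LTwo)) z ⟪κ, hΘ.modelKernel (hW hw)⟫_ℂ) :
    IsReproducing Θ z κ := by
  have hΘc := hΘ.differentiableOn.continuousOn
  obtain ⟨w₀, hw₀, h0⟩ : ∃ w ∈ W, Θ w ≠ 0 := by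
    by_contra! h0
    obtain ⟨w, hw, hw0⟩ := hΘ.exists_ne_zero
    exact hw0 (Set.EqOn.of_subset_closure (f := Θ) (g := fun _ => 0) h0 hΘc continuousOn_const
      hW hdense hw)
  obtain ⟨c, hc⟩ := hΘ.exists_hasNTLimit (hW hw₀) h0 (h w₀ hw₀)
  have hc1 : ‖c‖ ≤ 1 := by
    refine le_of_tendsto (hc.radial hz).norm ?_
    filter_upwards [Ioo_mem_nhdsLT (zero_lt_one' ℝ)] with r hr
    refine hΘ.norm_le_one (mem_ball_zero_iff.2 ?_)
    rw [norm_mul, hz, mul_one, Complex.norm_real, Real.norm_of_nonneg hr.1.le]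
    exact hr.2
  have hκ : ∀ w ∈ ball (0 : ℂ) 1,
      (1 - conj z * w) * discExtension (κ : LTwo) w = 1 - conj c * Θ w := by
    refine Set.EqOn.of_subset_closure (s := W)
      (f := fun w => (1 - conj z * w) * discExtension (κ : LTwo) w)
      (g := fun w => 1 - conj c * Θ w) (fun w hw => ?_) ?_ ?_ hW hdense
    · exact hΘ.discExtension_eq_of_inner_eq hz hc (hW hw) (h w hw)
    · exact ContinuousOn.mul (by fun_prop) (continuousOn_discExtension _)
    · exact continuousOn_const.sub (continuousOn_const.mul hΘc)
  -- The identity `hκ`, now valid in the whole disc, extends the hypothesis from `W` to every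
  -- kernel.
  refine hΘ.isReproducing_of_norm_modelKernel_le (fun w hw => ?_) fun M u hu huM =>
    hΘ.norm_modelKernel_le hz hc1 hu huM (hκ u hu)
  convert! hΘ.hasNTLimit_modelKernel hz hc hw using 1
  have h1 := congrArg conj (hκ w hw)
  rw [map_mul, ← hΘ.inner_modelKernel hw, inner_conj_symm κ (hΘ.modelKernel hw)] at h1
  simp only [map_sub, map_mul, map_one, Complex.conj_conj] at h1
  rw [eq_mul_inv_iff_mul_eq₀ (one_sub_conj_mul_ne_zero' hw hz)]
  linear_combination h1

end IsInner

/-! ### Orthonormal bases and pointwise evaluation -/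

theorem coeFn_finset_sum_smul {α ι : Type*} [MeasurableSpace α] {μ : Measure α} (s : Finset ι)
    (a : ι → ℂ) (F : ι → Lp ℂ 2 μ) :
    ((∑ i ∈ s, a i • F i : Lp ℂ 2 μ) : α → ℂ) =ᵐ[μ] fun z => ∑ i ∈ s, a i * (F i : α → ℂ) z := by
  classical
  induction s using Finset.induction_on with
  | empty =>
    simp only [Finset.sum_empty]
    exact Lp.coeFn_zero ℂ 2 μ
  | insert j s hj ih =>
    simp only [Finset.sum_insert hj]
    filter_upwards [Lp.coeFn_add (a j • F j) (∑ i ∈ s, a i • F i), Lp.coeFn_smul (a j) (F j), ih]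
      with z h1 h2 h3
    rw [h1, Pi.add_apply, h2, h3, Pi.smul_apply, smul_eq_mul]

section HilbertBasis

variable {E ι : Type*} [NormedAddCommGroup E] [InnerProductSpace ℂ E]

theorem exists_inner_hilbertBasis_eq (b : HilbertBasis ι ℂ E) {x : ι → ℂ}
    (hx : ∑' i, ‖x i‖ₑ ^ 2 ≠ ∞) : ∃ κ : E, ∀ i, ⟪κ, b i⟫_ℂ = x i := by
  have hs : Summable fun i => ‖x i‖ ^ 2 := by
    have h := ENNReal.summable_toReal hx
    simpa only [ENNReal.toReal_pow, toReal_enorm] using h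
  have hm : Memℓp (fun i => conj (x i)) 2 := by
    rw [memℓp_gen_iff (by norm_num)]
    simpa using hs
  refine ⟨b.repr.symm ⟨_, hm⟩, fun i => ?_⟩
  rw [← inner_conj_symm, ← b.repr_apply_apply, LinearIsometryEquiv.apply_symm_apply]
  exact Complex.conj_conj _

theorem tsum_enorm_inner_sq' (b : HilbertBasis ι ℂ E) (x : E) :
    ∑' i, ‖⟪x, b i⟫_ℂ‖ₑ ^ 2 = ‖x‖ₑ ^ 2 := by
  rw [← tsum_enorm_inner_sq b x]
  refine tsum_congr fun i => ?_
  rw [← inner_conj_symm, RCLike.enorm_conj]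

/-- If at almost every point `z` the functions `J (b i)` are represented by a vector `κ`, then so is
any given function `J f`. -/
theorem ae_apply_eq_inner {α : Type*} [MeasurableSpace α] {μ : Measure α} [Countable ι]
    (b : HilbertBasis ι ℂ E) (J : E →L[ℂ] Lp ℂ 2 μ) (f : E) :
    ∀ᵐ z ∂μ, ∀ κ : E, (∀ i, ⟪κ, b i⟫_ℂ = (J (b i) : α → ℂ) z) → (J f : α → ℂ) z = ⟪κ, f⟫_ℂ := by
  have hsum : HasSum (fun i => ⟪b i, f⟫_ℂ • J (b i)) (J f) := by
    have h := J.hasSum (b.hasSum_repr f)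
    simpa only [map_smul, b.repr_apply_apply] using h
  -- Convergence in `L²` gives almost everywhere convergence along a sequence of finite sets. The
  -- exceptional set is fixed before `κ` is chosen.
  obtain ⟨s, hs, hlim⟩ := (tendstoInMeasure_of_tendsto_Lp hsum).exists_seq_tendsto_ae'
  have hcoe : ∀ᵐ z ∂μ, ∀ n, ((∑ i ∈ s n, ⟪b i, f⟫_ℂ • J (b i) : Lp ℂ 2 μ) : α → ℂ) z =
      ∑ i ∈ s n, ⟪b i, f⟫_ℂ * (J (b i) : α → ℂ) z :=
    ae_all_iff.2 fun n => coeFn_finset_sum_smul _ _ _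
  filter_upwards [hlim, hcoe] with z h1 h2 κ hκ
  have h3 := (b.hasSum_inner_mul_inner κ f).comp hs
  refine tendsto_nhds_unique h1 (h3.congr fun n => ?_)
  rw [h2 n, Function.comp_apply]
  exact Finset.sum_congr rfl fun i _ => by simp only [hκ, mul_comm]

end HilbertBasis

/-- By Bessel, each Fourier monomial has nonzero inner product with only countably many `b i`, and
each `b i` is met by some monomial. Countability is what allows null sets to be united and sum and
integral to be exchanged. -/
theorem countable_hilbertBasis {Θ : ℂ → ℂ} {ι : Type*} (b : HilbertBasis ι ℂ (modelSpace Θ)) :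
    Countable ι := by
  have ho : Orthonormal ℂ fun i => ((b i : modelSpace Θ) : LTwo) :=
    b.orthonormal.comp_linearIsometry (modelSpace Θ).subtypeₗᵢ
  have hc : ∀ n : ℤ, {i | ⟪((b i : modelSpace Θ) : LTwo), fourierBasis n⟫_ℂ ≠ 0}.Countable := by
    intro n
    refine (ho.inner_products_summable (x := fourierBasis n)).countable_support.mono fun i hi => ?_
    exact pow_ne_zero 2 (norm_ne_zero_iff.2 hi)
  rw [← Set.countable_univ_iff]
  refine (Set.countable_iUnion hc).mono fun i _ => ?_
  by_contra h
  simp only [Set.mem_iUnion, Set.mem_ofPred_eq, not_exists, not_not] at h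
  refine ho.ne_zero i ((fourierBasis (T := (1 : ℝ))).repr.map_eq_zero_iff.1 (lp.ext ?_))
  funext n
  rw [HilbertBasis.repr_apply_apply, ← inner_conj_symm, h n, map_zero]
  rfl

/-! ### The embedding operator -/

section Embedding

variable {Θ : ℂ → ℂ} {μ : Measure ℂ}

theorem exists_countable_dense_ball :
    ∃ W : Set ℂ, W.Countable ∧ W ⊆ ball 0 1 ∧ ball (0 : ℂ) 1 ⊆ closure W := by
  obtain ⟨s, hs, hd⟩ := TopologicalSpace.exists_countable_dense ℂ
  exact ⟨ball 0 1 ∩ s, hs.mono Set.inter_subset_right, Set.inter_subset_left,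
    hd.open_subset_closure_inter isOpen_ball⟩

theorem IsInner.kernelNorm_eq_top (hΘ : IsInner Θ) {z : ℂ} (hz : ‖z‖ = 1)
    (h : ¬ ∃ κ : modelSpace Θ, IsReproducing Θ z κ) : kernelNorm Θ z = ∞ := by
  refine if_neg ?_
  rintro (h1 | h1)
  · exact h1.ne hz
  · exact h (hΘ.exists_isReproducing hz h1)

theorem IsEmbedding.ae_kernelNorm_sq_eq (hΘ : IsInner Θ) (hμ : μ (closedBall (0 : ℂ) 1)ᶜ = 0)
    {J : modelSpace Θ →L[ℂ] Lp ℂ 2 μ} (hJ : IsEmbedding Θ μ J) {ι : Type*}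
    (b : HilbertBasis ι ℂ (modelSpace Θ)) :
    ∀ᵐ z ∂μ, kernelNorm Θ z ^ 2 = ∑' i, ‖(J (b i) : ℂ → ℂ) z‖ₑ ^ 2 := by
  have := countable_hilbertBasis b
  obtain ⟨W, hWc, hW, hdense⟩ := exists_countable_dense_ball
  have hD : ∀ᵐ z ∂μ, z ∈ closedBall (0 : ℂ) 1 := hμ
  have hb := ae_all_iff.2 fun i => hJ (b i)
  have hk := (ae_ball_iff hWc).2 fun w hw =>
    (hJ (hΘ.modelKernel (hW hw))).and (ae_apply_eq_inner b J (hΘ.modelKernel (hW hw)))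
  filter_upwards [hD, hb, hk] with z hz hb hk
  rcases (mem_closedBall_zero_iff.1 hz).lt_or_eq with hlt | heq
  · have hz' := mem_ball_zero_iff.2 hlt
    rw [hΘ.kernelNorm_of_mem_ball hz', ← tsum_enorm_inner_sq' b]
    exact tsum_congr fun i => by rw [hΘ.inner_modelKernel, (hb i).1 hlt]
  · by_cases hrep : ∃ κ : modelSpace Θ, IsReproducing Θ z κ
    · obtain ⟨κ, hκ⟩ := hrep
      rw [hΘ.kernelNorm_of_isReproducing heq hκ, ← tsum_enorm_inner_sq' b]
      exact tsum_congr fun i => by rw [(hκ (b i)).unique heq ((hb i).2 heq)]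
    · rw [hΘ.kernelNorm_eq_top heq hrep, ENNReal.top_pow two_ne_zero]
      -- If the sum were finite, its terms would define a `κ` that reproduces at `z`, contrary to
      -- `hrep`.
      by_contra hne
      obtain ⟨κ, hκ⟩ := exists_inner_hilbertBasis_eq b (Ne.symm hne)
      refine hrep ⟨κ, hΘ.isReproducing_of_dense heq hW hdense fun w hw => ?_⟩
      rw [← (hk w hw).2 κ hκ]
      exact (hk w hw).1.2 heq

theorem enorm_sq_eq_lintegral (f : Lp ℂ 2 μ) :
    ‖f‖ₑ ^ 2 = ∫⁻ z, ‖(f : ℂ → ℂ) z‖ₑ ^ 2 ∂μ := by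
  have h := eLpNorm_nnreal_pow_eq_lintegral (μ := μ) (f := (f : ℂ → ℂ)) (p := 2) two_ne_zero
  simpa [Lp.enorm_def] using h

theorem aemeasurable_enorm_sq (f : Lp ℂ 2 μ) :
    AEMeasurable (fun z => ‖(f : ℂ → ℂ) z‖ₑ ^ 2) μ :=
  (Lp.aestronglyMeasurable f).enorm.pow_const 2

theorem IsEmbedding.hilbertSchmidtNormSq_eq (hΘ : IsInner Θ) (hμ : μ (closedBall (0 : ℂ) 1)ᶜ = 0)
    {J : modelSpace Θ →L[ℂ] Lp ℂ 2 μ} (hJ : IsEmbedding Θ μ J) :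
    hilbertSchmidtNormSq J = ∫⁻ z, kernelNorm Θ z ^ 2 ∂μ := by
  obtain ⟨w, b, -⟩ := exists_hilbertBasis ℂ (modelSpace Θ)
  have := countable_hilbertBasis b
  rw [ModelSpace.hilbertSchmidtNormSq_eq b J, lintegral_congr_ae (hJ.ae_kernelNorm_sq_eq hΘ hμ b),
    lintegral_tsum fun i => aemeasurable_enorm_sq (J (b i))]
  exact tsum_congr fun i => enorm_sq_eq_lintegral (J (b i))

/-- The definition of `kernelNorm` quantifies over all of the model space; measurability is read off
from the countable sum that equals its square almost everywhere. -/
theorem IsEmbedding.aemeasurable_kernelNorm (hΘ : IsInner Θ)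
    (hμ : μ (closedBall (0 : ℂ) 1)ᶜ = 0) {J : modelSpace Θ →L[ℂ] Lp ℂ 2 μ}
    (hJ : IsEmbedding Θ μ J) : AEMeasurable (kernelNorm Θ) μ := by
  obtain ⟨w, b, -⟩ := exists_hilbertBasis ℂ (modelSpace Θ)
  have := countable_hilbertBasis b
  have h1 : AEMeasurable (fun z => (∑' i, ‖(J (b i) : ℂ → ℂ) z‖ₑ ^ 2) ^ (1 / 2 : ℝ)) μ :=
    (AEMeasurable.tsum fun i => aemeasurable_enorm_sq (J (b i))).pow_const _
  refine h1.congr ?_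
  filter_upwards [hJ.ae_kernelNorm_sq_eq hΘ hμ b] with z hz
  rw [← hz, ← ENNReal.rpow_natCast, ← ENNReal.rpow_mul]
  norm_num

theorem eLpNorm_kernelNorm_sq :
    eLpNorm (kernelNorm Θ) 2 μ ^ 2 = ∫⁻ z, kernelNorm Θ z ^ 2 ∂μ := by
  have h := eLpNorm_nnreal_pow_eq_lintegral (μ := μ) (f := kernelNorm Θ) (p := 2) two_ne_zero
  simpa using h

theorem IsEmbedding.memLp_kernelNorm (hΘ : IsInner Θ) (hμ : μ (closedBall (0 : ℂ) 1)ᶜ = 0)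
    {J : modelSpace Θ →L[ℂ] Lp ℂ 2 μ} (hJ : IsEmbedding Θ μ J) (hHS : IsHilbertSchmidt J) :
    MemLp (kernelNorm Θ) 2 μ := by
  refine ⟨(hJ.aemeasurable_kernelNorm hΘ hμ).aestronglyMeasurable, ?_⟩
  have h : eLpNorm (kernelNorm Θ) 2 μ ^ 2 < ∞ := by
    rw [eLpNorm_kernelNorm_sq, ← hJ.hilbertSchmidtNormSq_eq hΘ hμ]
    exact hHS
  exact (ENNReal.pow_lt_top_iff.1 h).resolve_right two_ne_zero

/-! ### Construction of the embedding operator -/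

/-- One null set serves all `f` at once; off it, evaluation is linear in `f` and bounded by
`kernelNorm`. -/
theorem ae_exists_reproducing (hΘ : IsInner Θ) (hμ : μ (closedBall (0 : ℂ) 1)ᶜ = 0)
    (hk : MemLp (kernelNorm Θ) 2 μ) :
    ∀ᵐ z ∂μ, ‖z‖ ≤ 1 ∧ ∃ κ : modelSpace Θ, ‖κ‖ₑ = kernelNorm Θ z ∧
      (∀ f : modelSpace Θ, value (discExtension f) z = ⟪κ, f⟫_ℂ) ∧
      (‖z‖ = 1 → IsReproducing Θ z κ) := by
  have hD : ∀ᵐ z ∂μ, z ∈ closedBall (0 : ℂ) 1 := hμ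
  have hfin : ∀ᵐ z ∂μ, kernelNorm Θ z ^ 2 < ∞ := by
    refine ae_lt_top' (hk.1.aemeasurable.pow_const 2) ?_
    rw [← eLpNorm_kernelNorm_sq]
    exact ENNReal.pow_ne_top hk.2.ne
  filter_upwards [hD, hfin] with z hz hz'
  refine ⟨mem_closedBall_zero_iff.1 hz, ?_⟩
  rcases (mem_closedBall_zero_iff.1 hz).lt_or_eq with hlt | heq
  · have hb := mem_ball_zero_iff.2 hlt
    refine ⟨hΘ.modelKernel hb, (hΘ.kernelNorm_of_mem_ball hb).symm, fun f => ?_,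
      fun h => absurd h hlt.ne⟩
    rw [hΘ.inner_modelKernel, value_of_mem_ball hb]
  · by_cases hrep : ∃ κ : modelSpace Θ, IsReproducing Θ z κ
    · obtain ⟨κ, hκ⟩ := hrep
      exact ⟨κ, (hΘ.kernelNorm_of_isReproducing heq hκ).symm,
        fun f => (hκ f).value_eq heq, fun _ => hκ⟩
    · rw [hΘ.kernelNorm_eq_top heq hrep, ENNReal.top_pow two_ne_zero] at hz'
      exact absurd hz' (lt_irrefl _)

theorem tendsto_discExtension_radius {z : ℂ} (hz : ‖z‖ ≤ 1) {f : LTwo}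
    (h : ‖z‖ = 1 → HasNTLimit (discExtension f) z (value (discExtension f) z)) :
    Tendsto (fun n => discExtension f (radius n * z)) atTop (𝓝 (value (discExtension f) z)) := by
  rcases hz.lt_or_eq with hlt | heq
  · have hb := mem_ball_zero_iff.2 hlt
    rw [value_of_mem_ball hb]
    have h1 : Tendsto (fun n => (radius n : ℂ) * z) atTop (𝓝 (((1 : ℝ) : ℂ) * z)) :=
      ((Complex.continuous_ofReal.tendsto 1).comp tendsto_radius').mul_const z
    rw [Complex.ofReal_one, one_mul] at h1
    exact ((continuousOn_discExtension f).continuousAt (isOpen_ball.mem_nhds hb)).tendsto.comp h1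
  · exact ((h heq).radial heq).comp tendsto_radius

/-- The dilates `z ↦ f(rₙ z)` are continuous on the closed disc and converge to the value of `f`
almost everywhere. -/
theorem aestronglyMeasurable_value (hΘ : IsInner Θ) (hμ : μ (closedBall (0 : ℂ) 1)ᶜ = 0)
    (hk : MemLp (kernelNorm Θ) 2 μ) (f : modelSpace Θ) :
    AEStronglyMeasurable (value (discExtension f)) μ := by
  have hD : ∀ᵐ z ∂μ, z ∈ closedBall (0 : ℂ) 1 := hμ
  refine aestronglyMeasurable_of_tendsto_ae atTop
    (f := fun n z => discExtension f (radius n * z)) (fun n => ?_) ?_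
  · rw [← Measure.restrict_eq_self_of_ae_mem hD]
    refine ContinuousOn.aestronglyMeasurable ?_ measurableSet_closedBall
    refine (continuousOn_discExtension _).comp (by fun_prop) fun z hz => ?_
    rw [mem_closedBall_zero_iff] at hz
    rw [mem_ball_zero_iff, norm_mul, Complex.norm_real, Real.norm_of_nonneg (radius_nonneg n)]
    nlinarith [radius_nonneg n, radius_lt_one n, norm_nonneg z]
  · filter_upwards [ae_exists_reproducing hΘ hμ hk] with z hz
    obtain ⟨hz1, κ, -, hκ, hrep⟩ := hz
    refine tendsto_discExtension_radius hz1 fun heq => ?_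
    rw [hκ f]
    exact hrep heq f

theorem eLpNorm_value_le (hΘ : IsInner Θ) (hμ : μ (closedBall (0 : ℂ) 1)ᶜ = 0)
    (hk : MemLp (kernelNorm Θ) 2 μ) (f : modelSpace Θ) :
    eLpNorm (value (discExtension f)) 2 μ ≤ ‖f‖ₑ * eLpNorm (kernelNorm Θ) 2 μ := by
  refine eLpNorm_le_nnreal_smul_eLpNorm_of_ae_le_mul' (c := ‖f‖₊) ?_ 2
  filter_upwards [ae_exists_reproducing hΘ hμ hk] with z hz
  obtain ⟨-, κ, hκn, hκ, -⟩ := hz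
  rw [hκ f, enorm_eq_self, ← hκn, mul_comm]
  exact (ENNReal.coe_le_coe.2 (nnnorm_inner_le_nnnorm (𝕜 := ℂ) κ f)).trans_eq (ENNReal.coe_mul _ _)

theorem memLp_value (hΘ : IsInner Θ) (hμ : μ (closedBall (0 : ℂ) 1)ᶜ = 0)
    (hk : MemLp (kernelNorm Θ) 2 μ) (f : modelSpace Θ) :
    MemLp (value (discExtension f)) 2 μ :=
  ⟨aestronglyMeasurable_value hΘ hμ hk f, (eLpNorm_value_le hΘ hμ hk f).trans_lt
    (ENNReal.mul_lt_top enorm_lt_top hk.2)⟩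

/-- The embedding operator, when `z ↦ ‖k_z‖` is square-integrable. -/
def embedding (hΘ : IsInner Θ) (hμ : μ (closedBall (0 : ℂ) 1)ᶜ = 0)
    (hk : MemLp (kernelNorm Θ) 2 μ) : modelSpace Θ →L[ℂ] Lp ℂ 2 μ :=
  LinearMap.mkContinuous
    { toFun := fun f => (memLp_value hΘ hμ hk f).toLp _
      map_add' := fun f g => by
        refine Lp.ext ?_
        filter_upwards [ae_exists_reproducing hΘ hμ hk, (memLp_value hΘ hμ hk (f + g)).coeFn_toLp,
          (memLp_value hΘ hμ hk f).coeFn_toLp, (memLp_value hΘ hμ hk g).coeFn_toLp,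
          Lp.coeFn_add ((memLp_value hΘ hμ hk f).toLp _) ((memLp_value hΘ hμ hk g).toLp _)]
          with z hz h1 h2 h3 h4
        obtain ⟨-, κ, -, hκ, -⟩ := hz
        rw [h1, h4, Pi.add_apply, h2, h3, hκ, hκ, hκ, inner_add_right]
      map_smul' := fun c f => by
        refine Lp.ext ?_
        filter_upwards [ae_exists_reproducing hΘ hμ hk, (memLp_value hΘ hμ hk (c • f)).coeFn_toLp,
          (memLp_value hΘ hμ hk f).coeFn_toLp, Lp.coeFn_smul c ((memLp_value hΘ hμ hk f).toLp _)]
          with z hz h1 h2 h3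
        obtain ⟨-, κ, -, hκ, -⟩ := hz
        rw [h1, RingHom.id_apply, h3, Pi.smul_apply, h2, hκ, hκ]
        exact inner_smul_right κ f c }
    (eLpNorm (kernelNorm Θ) 2 μ).toReal fun f => by
      change ‖(memLp_value hΘ hμ hk f).toLp _‖ ≤ _
      have h := ENNReal.toReal_mono (ENNReal.mul_ne_top enorm_ne_top hk.2.ne)
        (eLpNorm_value_le hΘ hμ hk f)
      rwa [ENNReal.toReal_mul, toReal_enorm, mul_comm, ← Lp.norm_toLp _ (memLp_value hΘ hμ hk f)]
        at h

theorem isEmbedding_embedding (hΘ : IsInner Θ) (hμ : μ (closedBall (0 : ℂ) 1)ᶜ = 0)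
    (hk : MemLp (kernelNorm Θ) 2 μ) : IsEmbedding Θ μ (embedding hΘ hμ hk) := by
  intro f
  filter_upwards [ae_exists_reproducing hΘ hμ hk, (memLp_value hΘ hμ hk f).coeFn_toLp] with z hz h1
  obtain ⟨-, κ, -, hκ, hrep⟩ := hz
  have h2 : (embedding hΘ hμ hk f : ℂ → ℂ) z = value (discExtension f) z := h1
  rw [h2]
  refine ⟨fun h => value_of_mem_ball (mem_ball_zero_iff.2 h), fun h => ?_⟩
  rw [hκ f]
  exact hrep h f

theorem isHilbertSchmidt_embedding (hΘ : IsInner Θ) (hμ : μ (closedBall (0 : ℂ) 1)ᶜ = 0)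
    (hk : MemLp (kernelNorm Θ) 2 μ) : IsHilbertSchmidt (embedding hΘ hμ hk) := by
  rw [IsHilbertSchmidt, (isEmbedding_embedding hΘ hμ hk).hilbertSchmidtNormSq_eq hΘ hμ,
    ← eLpNorm_kernelNorm_sq]
  exact ENNReal.pow_lt_top hk.2

end Embedding

end ModelSpace

end

theorem proposition5p1 (Θ : ℂ → ℂ) (hΘ : ModelSpace.IsInner Θ)
    (μ : Measure ℂ) [IsFiniteMeasure μ] (hμ : μ (closedBall (0 : ℂ) 1)ᶜ = 0) :
    ((∃ J : ModelSpace.modelSpace Θ →L[ℂ] Lp ℂ 2 μ,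
        ModelSpace.IsEmbedding Θ μ J ∧ ModelSpace.IsHilbertSchmidt J) ↔
      MemLp (ModelSpace.kernelNorm Θ) 2 μ) ∧
    ∀ J : ModelSpace.modelSpace Θ →L[ℂ] Lp ℂ 2 μ, ModelSpace.IsEmbedding Θ μ J →
      ModelSpace.hilbertSchmidtNormSq J = ∫⁻ z, ModelSpace.kernelNorm Θ z ^ 2 ∂μ := by
  refine ⟨⟨fun ⟨J, hJ, hHS⟩ => hJ.memLp_kernelNorm hΘ hμ hHS, fun hk =>
    ⟨ModelSpace.embedding hΘ hμ hk, ModelSpace.isEmbedding_embedding hΘ hμ hk,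
      ModelSpace.isHilbertSchmidt_embedding hΘ hμ hk⟩⟩, fun J hJ => ?_⟩
  exact hJ.hilbertSchmidtNormSq_eq hΘ hμ
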